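/- Let $p\ge 1$, $\upsilon\ge 1$ and $n\ge 0$ be integers and let $H,C\in\mathbb C^{p\times p}$ satisfy $HC=CH$, $\operatorname{Re} z>-1$ for every eigenvalue $z$ of $C$, and $\operatorname{Re} x>1+(1+\upsilon)n$ for every eigenvalue $x$ of $H$. For a square matrix $S$ put $(S)_0=I$, $(S)_k=S(S+I)\cdots(S+(k-1)I)$ for $k\ge1$, and $u^{S}=\exp(S\ln u)$ for $u>0$. Define $$M_n^{(H,C)}(u;\upsilon)=\sum_{j=0}^n(-1)^{j+n}\binom nj\big((n+1)I-H\big)_{\upsilon j}\,(I+C)_{\upsilon n}\,\big((I+C)_{\upsilon j}\big)^{-1}(-u)^{\upsilon j},$$ $$\mathcal M_n^{(H,C)}(u;\upsilon)=\sum_{s=0}^n\sum_{j=0}^s\frac{(-1)^{j+n}}{s!}\binom sj\Big(\tfrac1\upsilon\big((j+1)I+C\big)\Big)_n\big(H+C-nI\big)_s\,u^s(1+u)^{n-s}.$$ Then, all integrals being (entrywise) absolutely convergent for $0\le i\le n$, $$\int_0^\infty u^C(1+u)^{-(H+C)}M_n^{(H,C)}(u;\upsilon)\,u^i\,du\ \begin{cases}=0,&0\le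 i<n,\\ \ne0,&i=n,\end{cases}$$ $$\int_0^\infty u^C(1+u)^{-(H+C)}\mathcal M_n^{(H,C)}(u;\upsilon)\,u^{\upsilon i}\,du\ \begin{cases}=0,&0\le i<n,\\ \ne0,&i=n,\end{cases}$$ where $0$ denotes the zero matrix. -/

import Mathlib

open MeasureTheory

noncomputable section

/-- The real power `u ^ S = exp (S log u)` of a square complex matrix, for `u > 0`. -/
def matPow {p : ℕ} (u : ℝ) (S : Matrix (Fin p) (Fin p) ℂ) : Matrix (Fin p) (Fin p) ℂ :=
  NormedSpace.exp (((Real.log u : ℝ) : ℂ) • S)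

/-- The matrix Pochhammer symbol `(S)_k = S (S + I) ⋯ (S + (k - 1) I)`, with `(S)_0 = I`. -/
def matPoch {p : ℕ} (S : Matrix (Fin p) (Fin p) ℂ) (k : ℕ) : Matrix (Fin p) (Fin p) ℂ :=
  Polynomial.aeval S (ascPochhammer ℂ k)

theorem matPoch_zero {p : ℕ} (S : Matrix (Fin p) (Fin p) ℂ) : matPoch S 0 = 1 := by
  simp [matPoch]

theorem matPoch_succ {p : ℕ} (S : Matrix (Fin p) (Fin p) ℂ) (k : ℕ) :
    matPoch S (k + 1) = matPoch S k * (S + (k : ℂ) • (1 : Matrix (Fin p) (Fin p) ℂ)) := by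
  simp [matPoch, ascPochhammer_succ_right, Algebra.smul_def]

/-- The first polynomial `M_n^{(H,C)}(u; υ)` of the finite biorthogonal pair. -/
def biorthM {p : ℕ} (υ n : ℕ) (H C : Matrix (Fin p) (Fin p) ℂ) (u : ℝ) :
    Matrix (Fin p) (Fin p) ℂ :=
  ∑ j ∈ Finset.range (n + 1),
    ((-1 : ℂ) ^ (j + n) * (n.choose j : ℂ) * (-(u : ℂ)) ^ (υ * j)) •
      (matPoch (((n : ℂ) + 1) • (1 : Matrix (Fin p) (Fin p) ℂ) - H) (υ * j) *
        matPoch (1 + C) (υ * n) * (matPoch (1 + C) (υ * j))⁻¹)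

/-- The second polynomial `ℳ_n^{(H,C)}(u; υ)` of the finite biorthogonal pair. -/
def biorthCalM {p : ℕ} (υ n : ℕ) (H C : Matrix (Fin p) (Fin p) ℂ) (u : ℝ) :
    Matrix (Fin p) (Fin p) ℂ :=
  ∑ s ∈ Finset.range (n + 1), ∑ j ∈ Finset.range (s + 1),
    ((-1 : ℂ) ^ (j + n) / (s.factorial : ℂ) * (s.choose j : ℂ) *
        ((u : ℂ) ^ s * (1 + (u : ℂ)) ^ (n - s))) •
      (matPoch ((1 / (υ : ℂ)) • (((j : ℂ) + 1) • (1 : Matrix (Fin p) (Fin p) ℂ) + C)) n *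
        matPoch (H + C - (n : ℂ) • (1 : Matrix (Fin p) (Fin p) ℂ)) s)

/-- The matrix weight `u ^ C (1 + u) ^ (-(H + C))`. -/
def matWeight {p : ℕ} (H C : Matrix (Fin p) (Fin p) ℂ) (u : ℝ) : Matrix (Fin p) (Fin p) ℂ :=
  matPow u C * matPow (1 + u) (-(H + C))

/-- Every entry of `F` is absolutely integrable on `(0, ∞)`. -/
def MatIntegrable {p : ℕ} (F : ℝ → Matrix (Fin p) (Fin p) ℂ) : Prop :=
  ∀ a b, IntegrableOn (fun u => F u a b) (Set.Ioi 0)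

/-- The entrywise integral of a matrix function over `(0, ∞)`. -/
def matIntegral {p : ℕ} (F : ℝ → Matrix (Fin p) (Fin p) ℂ) : Matrix (Fin p) (Fin p) ℂ :=
  Matrix.of fun a b => ∫ u in Set.Ioi (0 : ℝ), F u a b

end

/-! Since `H` and `C` commute, everything except the weight lives in the commutative algebra they
generate, and the integrals reduce to the moments of `u^k (1+u)^m W(u)`, with `W` the weight.
Differentiating `u^(k+1) (1+u)^(m+1) W` and integrating over the half-line gives one recurrence
(`weightMoment_recurrence`). The spectral hypotheses supply integrability and kill the boundary
terms. Iterated, it yields two relations, with `K (k, m)` the moment and `J k = K (k, 0)`: `(2-H)_k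
J k = (-1)^k (1+C)_k J 0` and `(H+C-n)_s K (k+s, n-s) = (1+C+k)_s K (k, n)`.

For the first polynomial, multiplying by the invertible `(2-H)_(n-1)` turns the integral against
`u^i` into an alternating binomial sum of a polynomial in `j` of degree at most `n-1`, so it is an
`n`-th finite difference and vanishes for `i < n`. For `i = n` one linear factor is missing from
each term. Multiplying by all the missing factors produces a Lagrange interpolation sum with an
explicit value.

For the second polynomial, the double sum is the Newton series of `P(x) = ((x+1+C)/υ)_n` evaluated
at `-(1+C+υi)`, that is `(-i)_n`, which is zero exactly when `i < n` in the range `i ≤ n`.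

Nonvanishing at `i = n` is tested on a joint eigenvector of `H` and `C`, where the moments act as
Beta integrals and all the factors are nonzero scalars. -/

/-! ### Finite differences, Lagrange interpolation and Newton series -/

section PochhammerIdentities

open Polynomial Finset

theorem ascPochhammer_eval_add_index {R : Type*} [CommRing R] (a : R) (k l : ℕ) :
    (ascPochhammer R (k + l)).eval a =
      (ascPochhammer R k).eval a * (ascPochhammer R l).eval (a + k) := by
  rw [← ascPochhammer_mul]
  simp [eval_comp]

theorem natDegree_ascPochhammer_le (R : Type*) [CommRing R] (k : ℕ) :
    (ascPochhammer R k).natDegree ≤ k := by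
  rw [← ascPochhammer_map (Int.castRingHom R) k]
  exact natDegree_map_le.trans (ascPochhammer_natDegree ℤ k).le

theorem natDegree_ascPochhammer_comp_linear_le {R : Type*} [CommRing R] (k : ℕ) (a b : R) :
    ((ascPochhammer R k).comp (C a + C b * X)).natDegree ≤ k := by
  refine natDegree_comp_le.trans ?_
  have h1 : (C a + C b * X).natDegree ≤ 1 := by
    rw [add_comm]
    exact natDegree_linear_le
  calc _ ≤ k * 1 := Nat.mul_le_mul (natDegree_ascPochhammer_le R k) h1
    _ = k := mul_one k

theorem sum_neg_one_pow_choose_mul_eval_eq_zero {R : Type*} [CommRing R] {P : R[X]} {n : ℕ}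
    (hP : P.natDegree < n) :
    ∑ j ∈ range (n + 1), (-1 : R) ^ j * (n.choose j : R) * P.eval (j : R) = 0 := by
  have h := congrFun (fwdDiff_iter_eq_zero_of_degree_lt hP) 0
  rw [fwdDiff_iter_eq_sum_shift] at h
  have h2 : (-1 : R) ^ n * ∑ k ∈ range (n + 1),
      ((-1 : ℤ) ^ (n - k) * n.choose k) • P.eval ((0 : R) + k • 1) = 0 := by
    rw [h]; simp
  rw [mul_sum] at h2
  rw [← h2]
  refine sum_congr rfl fun j hj => ?_
  have hj' : j ≤ n := Nat.lt_succ_iff.mp (mem_range.mp hj)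
  obtain ⟨m, rfl⟩ := Nat.exists_eq_add_of_le hj'
  have hs : (-1 : R) ^ m * (-1) ^ m = 1 := by rw [← mul_pow]; simp
  simp only [zsmul_eq_mul, nsmul_eq_mul, Nat.add_sub_cancel_left, pow_add]
  push_cast
  simp only [zero_add, mul_one]
  linear_combination (-(-1 : R) ^ j * ((j + m).choose j : R) * P.eval (j : R)) * hs

theorem prod_erase_natCast_sub {F : Type*} [CommRing F] (i m : ℕ) :
    ∏ l ∈ (range (i + m + 1)).erase i, ((i : F) - l) =
      (-1) ^ m * (i.factorial : F) * (m.factorial : F) := by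
  induction m with
  | zero =>
    rw [add_zero, range_add_one, erase_insert (by simp)]
    simp only [pow_zero, one_mul, Nat.factorial_zero, Nat.cast_one, mul_one]
    rw [← prod_range_add_one_eq_factorial, Nat.cast_prod, ← prod_range_reflect]
    refine prod_congr rfl fun l hl => ?_
    have : l < i := mem_range.mp hl
    obtain ⟨t, rfl⟩ := Nat.exists_eq_add_of_lt this
    have : l + t + 1 - 1 - l = t := by omega
    rw [this]; push_cast; ring
  | succ m ih =>
    rw [← add_assoc, range_add_one, erase_insert_of_ne (by omega), prod_insert (by simp), ih]
    rw [Nat.factorial_succ]; push_cast; ring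

/-- Lagrange interpolation of `X^d` at the nodes `0, …, n`, cleared of denominators. Both sides have
degree at most `n`, and at node `i` only the term `j = i` survives, with product `(-1)^(n-i) i!
(n-i)!`. -/
theorem sum_choose_mul_pow_mul_prod_X_sub (n d : ℕ) (hd : d ≤ n) :
    ∑ j ∈ range (n + 1), C ((-1 : ℂ) ^ (n - j) * (n.choose j : ℂ) * (j : ℂ) ^ d) *
      ∏ l ∈ (range (n + 1)).erase j, (X - C (l : ℂ)) = C (n.factorial : ℂ) * X ^ d := by
  refine Polynomial.eq_of_degrees_lt_of_eval_index_eq (v := fun i : ℕ => (i : ℂ)) (range (n + 1))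
    (fun a _ b _ h => by simpa using h) ?_ ?_ ?_
  · rw [card_range]
    refine (degree_sum_le _ _).trans_lt ?_
    rw [Finset.sup_lt_iff (by exact WithBot.bot_lt_coe _)]
    intro j hj
    rw [← smul_eq_C_mul]
    refine (degree_smul_le _ _).trans_lt ?_
    rw [degree_prod]
    simp only [degree_X_sub_C, sum_const, card_erase_of_mem hj, card_range]
    simp only [nsmul_eq_mul, Nat.add_sub_cancel, mul_one]
    exact_mod_cast Nat.lt_succ_self n
  · rw [card_range]
    refine (degree_C_mul_X_pow_le _ _).trans_lt ?_
    exact_mod_cast Nat.lt_succ_of_le hd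
  · intro i hi
    rw [eval_finsetSum, sum_eq_single_of_mem i hi]
    · obtain ⟨m, rfl⟩ := Nat.exists_eq_add_of_le (Nat.lt_succ_iff.mp (mem_range.mp hi))
      simp only [eval_mul, eval_C, eval_prod, eval_sub, eval_X, eval_pow, prod_erase_natCast_sub]
      have hs : (-1 : ℂ) ^ m * (-1) ^ m = 1 := by rw [← mul_pow]; simp
      have hf : (((i + m).choose i : ℕ) : ℂ) * (i.factorial : ℂ) * (m.factorial : ℂ) =
          ((i + m).factorial : ℂ) := by
        have := Nat.choose_mul_factorial_mul_factorial (Nat.le_add_right i m)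
        rw [Nat.add_sub_cancel_left] at this
        exact_mod_cast this
      rw [Nat.add_sub_cancel_left, ← hf]
      linear_combination ((i + m).choose i * (i : ℂ) ^ d * i.factorial * m.factorial) * hs
    · intro j _ hji
      rw [eval_mul, eval_prod, prod_eq_zero (mem_erase.mpr ⟨hji.symm, hi⟩), mul_zero]
      simp

/-- `R` may have zero divisors, so interpolation is done over `ℂ` for monomials, evaluated at `a`,
and extended by linearity in the coefficients of `P`. -/
theorem sum_choose_mul_eval_mul_prod_sub {R : Type*} [CommRing R] [Algebra ℂ R] {n : ℕ} (P : R[X])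
    (hP : P.natDegree ≤ n) (a : R) :
    ∑ j ∈ range (n + 1), (-1 : R) ^ (n - j) * (n.choose j : R) * P.eval (j : R) *
      ∏ l ∈ (range (n + 1)).erase j, (a - l) = (n.factorial : R) * P.eval a := by
  have key : ∀ d ≤ n, ∑ j ∈ range (n + 1), (-1 : R) ^ (n - j) * (n.choose j : R) * (j : R) ^ d *
      ∏ l ∈ (range (n + 1)).erase j, (a - l) = (n.factorial : R) * a ^ d := by
    intro d hd
    have := congrArg (aeval a) (sum_choose_mul_pow_mul_prod_X_sub n d hd)
    simpa [map_sum, map_prod] using this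
  simp only [P.eval_eq_sum_range' (Nat.lt_succ_of_le hP), mul_sum, sum_mul]
  rw [sum_comm]
  refine sum_congr rfl fun d hd => ?_
  have := key d (Nat.lt_succ_iff.mp (mem_range.mp hd))
  calc _ = P.coeff d * ∑ j ∈ range (n + 1), (-1 : R) ^ (n - j) * (n.choose j : R) * (j : R) ^ d *
      ∏ l ∈ (range (n + 1)).erase j, (a - l) := by
        rw [mul_sum]
        exact sum_congr rfl fun j _ => by ring
    _ = _ := by rw [this]; ring

theorem ascPochhammer_eval_neg_natCast (m s : ℕ) :
    (ascPochhammer ℂ s).eval (-(m : ℂ)) = (-1) ^ s * (s.factorial : ℂ) * (m.choose s : ℂ) := by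
  rw [ascPochhammer_eval_neg_eq_descPochhammer, descPochhammer_eval_eq_descFactorial,
    Nat.descFactorial_eq_factorial_mul_choose]
  push_cast; ring

/-- At `X = -m` one has `(-m)_s = (-1)^s s! (m choose s)`, and the identity becomes the
Gregory–Newton formula for `m^d`. Infinitely many such points determine the polynomial. -/
theorem newton_pow_polynomial (n d : ℕ) (hd : d ≤ n) :
    ∑ s ∈ range (n + 1), C ((s.factorial : ℂ)⁻¹ *
      ∑ j ∈ range (s + 1), (-1 : ℂ) ^ j * (s.choose j : ℂ) * (j : ℂ) ^ d) * ascPochhammer ℂ s =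
      (-X) ^ d := by
  refine Polynomial.eq_of_infinite_eval_eq _ _ (Set.infinite_of_injective_forall_mem
    (f := fun m : ℕ => (-(m : ℂ))) (fun a b h => by simpa using h) fun m => ?_)
  have hdiff : ∀ s, (-1 : ℂ) ^ s *
      ∑ j ∈ range (s + 1), (-1 : ℂ) ^ j * (s.choose j : ℂ) * (j : ℂ) ^ d =
      (fwdDiff (1 : ℂ))^[s] (fun r : ℂ => r ^ d) 0 := by
    intro s
    rw [fwdDiff_iter_eq_sum_shift, mul_sum]
    refine sum_congr rfl fun j hj => ?_
    obtain ⟨t, rfl⟩ := Nat.exists_eq_add_of_le (Nat.lt_succ_iff.mp (mem_range.mp hj))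
    have hs : (-1 : ℂ) ^ j * (-1) ^ j = 1 := by rw [← mul_pow]; simp
    simp only [zsmul_eq_mul, nsmul_eq_mul, Nat.add_sub_cancel_left, pow_add]
    push_cast
    simp only [zero_add, mul_one]
    linear_combination ((-1 : ℂ) ^ t * ((j + t).choose j : ℂ) * (j : ℂ) ^ d) * hs
  have hN := shift_eq_sum_fwdDiff_iter (1 : ℂ) (fun r : ℂ => r ^ d) m 0
  -- The truncations at `m` and at `n` are compared through `n + m`: the extra terms vanish by the
  -- binomial coefficient in one case and by the order of the difference exceeding `d` in the other.
  have e1 : ∑ k ∈ range (m + 1), m.choose k • (fwdDiff (1 : ℂ))^[k] (fun r : ℂ => r ^ d) 0 =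
      ∑ k ∈ range (n + m + 1), m.choose k • (fwdDiff (1 : ℂ))^[k] (fun r : ℂ => r ^ d) 0 := by
    refine sum_subset (range_subset_range.mpr (by omega)) fun k _ hk => ?_
    rw [Nat.choose_eq_zero_of_lt (by simpa using hk), zero_smul]
  have e2 : ∑ k ∈ range (n + 1), m.choose k • (fwdDiff (1 : ℂ))^[k] (fun r : ℂ => r ^ d) 0 =
      ∑ k ∈ range (n + m + 1), m.choose k • (fwdDiff (1 : ℂ))^[k] (fun r : ℂ => r ^ d) 0 := by
    refine sum_subset (range_subset_range.mpr (by omega)) fun k _ hk => ?_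
    have : d < k := by have : n + 1 ≤ k := by simpa using hk
                       omega
    rw [fwdDiff_iter_pow_eq_zero_of_lt this, Pi.zero_apply, smul_zero]
  rw [Set.mem_ofPred_eq, eval_finsetSum]
  have e3 : eval (-(m : ℂ)) ((-X : ℂ[X]) ^ d) = (0 + m • (1 : ℂ)) ^ d := by simp
  rw [e3, hN, e1, ← e2]
  refine sum_congr rfl fun s _ => ?_
  rw [← hdiff, eval_mul, eval_C, ascPochhammer_eval_neg_natCast, nsmul_eq_mul]
  have : (s.factorial : ℂ) ≠ 0 := by exact_mod_cast s.factorial_ne_zero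
  field_simp

theorem newton_series_eval_neg {R : Type*} [CommRing R] [Algebra ℂ R] {n : ℕ} (P : R[X])
    (hP : P.natDegree ≤ n) (y : R) :
    ∑ s ∈ range (n + 1), algebraMap ℂ R (s.factorial : ℂ)⁻¹ *
      (∑ j ∈ range (s + 1), (-1 : R) ^ j * (s.choose j : R) * P.eval (j : R)) *
        (ascPochhammer R s).eval y = P.eval (-y) := by
  have key : ∀ d ≤ n, ∑ s ∈ range (n + 1), algebraMap ℂ R (s.factorial : ℂ)⁻¹ *
      (∑ j ∈ range (s + 1), (-1 : R) ^ j * (s.choose j : R) * (j : R) ^ d) *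
        (ascPochhammer R s).eval y = (-y) ^ d := by
    intro d hd
    have h := congrArg (aeval y) (newton_pow_polynomial n d hd)
    have e : ∀ s, aeval y (ascPochhammer ℂ s) = (ascPochhammer R s).eval y := by
      intro s
      rw [← ascPochhammer_map (algebraMap ℂ R), eval_map_algebraMap]
    simpa [map_sum, e] using h
  simp only [P.eval_eq_sum_range' (Nat.lt_succ_of_le hP)]
  rw [← sum_congr rfl fun d hd =>
    congrArg (P.coeff d * ·) (key d (Nat.lt_succ_iff.mp (mem_range.mp hd)))]
  simp only [mul_sum, sum_mul]
  rw [sum_comm (s := range (n + 1)) (t := range (n + 1))]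
  refine sum_congr rfl fun s _ => ?_
  rw [sum_comm]
  exact sum_congr rfl fun d _ => sum_congr rfl fun j _ => by ring

end PochhammerIdentities

/-! ### Algebraic consequences of the moment relations -/

section MomentIdentities

open Polynomial Finset

variable {R M : Type*} [CommRing R] [AddCommGroup M] [Module R M]

/-- The prefactor is chosen so that `(2-h)_(n-1) (n+1-h)_(υj) = (2-h)_(n-1+υj)`, which contains
`(2-h)_(υj+i)` because `i ≤ n-1`. The moment relation then replaces `J (υj+i)` by `J 0`, and what
depends on `j`, apart from signs and the binomial, is a polynomial of degree at most `(n-1-i) + i <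
n`. -/
theorem ascPochhammer_smul_sum_moments_eq_zero (c h : R) {υ n i : ℕ} (hi : i < n) (J : ℕ → M)
    (hJ : ∀ k ≤ υ * n + i, (ascPochhammer R k).eval (2 - h) • J k =
      ((-1) ^ k * (ascPochhammer R k).eval (1 + c)) • J 0) :
    (ascPochhammer R (n - 1)).eval (2 - h) • ∑ j ∈ range (n + 1),
      ((-1) ^ (j + n) * (n.choose j : R) * (-1) ^ (υ * j) *
        ((ascPochhammer R (υ * j)).eval (n + 1 - h) *
          (ascPochhammer R (υ * (n - j))).eval (1 + c + (υ * j : ℕ)))) • J (υ * j + i) = 0 := by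
  obtain ⟨m, rfl⟩ : ∃ m, n = i + m + 1 := ⟨n - i - 1, by omega⟩
  set n := i + m + 1 with hn
  let P : R[X] := (ascPochhammer R m).comp (C (2 - h + i) + C (υ : R) * X) *
    (ascPochhammer R i).comp (C (1 + c) + C (υ : R) * X)
  have hP : P.natDegree < n := by
    refine (natDegree_mul_le.trans (add_le_add (natDegree_ascPochhammer_comp_linear_le _ _ _)
      (natDegree_ascPochhammer_comp_linear_le _ _ _))).trans_lt ?_
    omega
  have hsum := sum_neg_one_pow_choose_mul_eval_eq_zero hP
  have hz : ((-1) ^ (n + i) * (ascPochhammer R (υ * n)).eval (1 + c) *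
      ∑ j ∈ range (n + 1), (-1 : R) ^ j * (n.choose j : R) * P.eval (j : R)) • J 0 = 0 := by
    rw [hsum, mul_zero, zero_smul]
  rw [← hz, mul_sum, sum_smul, smul_sum]
  refine sum_congr rfl fun j hj => ?_
  have hjn : j ≤ n := Nat.lt_succ_iff.mp (mem_range.mp hj)
  have hk : υ * j + i ≤ υ * n + i := Nat.add_le_add_right (Nat.mul_le_mul_left υ hjn) i
  have h1 : (ascPochhammer R (n - 1)).eval (2 - h) * (ascPochhammer R (υ * j)).eval (n + 1 - h) =
      (ascPochhammer R m).eval (2 - h + (υ * j + i : ℕ)) *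
        (ascPochhammer R (υ * j + i)).eval (2 - h) := by
    have e1 := ascPochhammer_eval_add_index (2 - h) (n - 1) (υ * j)
    have e2 := ascPochhammer_eval_add_index (2 - h) (υ * j + i) m
    have e3 : n - 1 + υ * j = υ * j + i + m := by omega
    have e4 : 2 - h + ((n - 1 : ℕ) : R) = n + 1 - h := by
      rw [hn]; simp only [Nat.add_sub_cancel]; push_cast; ring
    rw [e4, e3, e2] at e1
    rw [← e1, mul_comm]
  have h2 : (ascPochhammer R (υ * (n - j))).eval (1 + c + (υ * j : ℕ)) *
      (ascPochhammer R (υ * j + i)).eval (1 + c) =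
      (ascPochhammer R (υ * n)).eval (1 + c) * (ascPochhammer R i).eval (1 + c + (υ * j : ℕ)) := by
    have e1 := ascPochhammer_eval_add_index (1 + c) (υ * j) (υ * (n - j))
    rw [← Nat.mul_add, Nat.add_sub_cancel' hjn] at e1
    rw [e1, ascPochhammer_eval_add_index (1 + c) (υ * j) i]
    ring
  have hs : (-1 : R) ^ (υ * j) * (-1) ^ (υ * j) = 1 := by rw [← mul_pow]; simp
  have hPe : P.eval (j : R) = (ascPochhammer R m).eval (2 - h + (υ * j + i : ℕ)) *
      (ascPochhammer R i).eval (1 + c + (υ * j : ℕ)) := by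
    simp only [P, eval_mul, eval_comp, eval_add, eval_C, eval_X]
    push_cast
    congr 2
    ring
  rw [smul_smul]
  calc _ = ((-1) ^ (j + n) * (n.choose j : R) * (-1) ^ (υ * j) *
        (ascPochhammer R (υ * (n - j))).eval (1 + c + (υ * j : ℕ)) *
        (ascPochhammer R m).eval (2 - h + (υ * j + i : ℕ))) •
        ((ascPochhammer R (υ * j + i)).eval (2 - h) • J (υ * j + i)) := by
        rw [smul_smul]
        congr 1
        linear_combination ((-1) ^ (j + n) * (n.choose j : R) * (-1) ^ (υ * j) *
          (ascPochhammer R (υ * (n - j))).eval (1 + c + (υ * j : ℕ))) * h1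
    _ = _ := by
        rw [hJ _ hk, smul_smul, hPe]
        congr 1
        rw [pow_add (-1 : R) (υ * j) i, pow_add, pow_add]
        linear_combination ((-1) ^ j * (-1) ^ n * (n.choose j : R) * (-1) ^ (υ * j) *
          (-1) ^ (υ * j) * (-1) ^ i * (ascPochhammer R m).eval (2 - h + (υ * j + i : ℕ))) * h2 +
          ((-1) ^ j * (-1) ^ n * (n.choose j : R) * (-1) ^ i *
            (ascPochhammer R m).eval (2 - h + (υ * j + i : ℕ)) *
            (ascPochhammer R (υ * n)).eval (1 + c) *
            (ascPochhammer R i).eval (1 + c + (υ * j : ℕ))) * hs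

/-- Here `(2-h)_(n-1+υj)` falls one factor, `n+1-h+υj`, short of `(2-h)_(υj+n)`. The full product
over `l` supplies it and leaves the factors with `l ≠ j`, the numerator of a Lagrange basis
polynomial. -/
theorem ascPochhammer_smul_sum_moments_eq [Algebra ℂ R] (c h : R) {υ n : ℕ} (hυ : 1 ≤ υ)
    (hn : 1 ≤ n) (J : ℕ → M)
    (hJ : ∀ k ≤ υ * n + n, (ascPochhammer R k).eval (2 - h) • J k =
      ((-1) ^ k * (ascPochhammer R k).eval (1 + c)) • J 0) :
    ((ascPochhammer R (n - 1)).eval (2 - h) * ∏ l ∈ range (n + 1), (n + 1 - h + (υ * l : ℕ))) •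
      ∑ j ∈ range (n + 1), ((-1) ^ (j + n) * (n.choose j : R) * (-1) ^ (υ * j) *
        ((ascPochhammer R (υ * j)).eval (n + 1 - h) *
          (ascPochhammer R (υ * (n - j))).eval (1 + c + (υ * j : ℕ)))) • J (υ * j + n) =
      ((υ : R) ^ n * (n.factorial : R) * (ascPochhammer R (υ * n)).eval (1 + c) *
        (ascPochhammer R n).eval (c + h - n)) • J 0 := by
  obtain ⟨ι, hι⟩ : ∃ ι : R, (υ : R) * ι = 1 := by
    refine ⟨algebraMap ℂ R (υ : ℂ)⁻¹, ?_⟩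
    rw [← map_natCast (algebraMap ℂ R), ← map_mul, mul_inv_cancel₀, map_one]
    exact_mod_cast (by omega : υ ≠ 0)
  -- The interpolation point is the one for which `n+1-h+υl = -υ(a-l)`.
  let a : R := ι * (h - n - 1)
  have ha : (υ : R) * a = h - n - 1 := by
    simp only [a]; rw [← mul_assoc, hι, one_mul]
  let P : R[X] := (ascPochhammer R n).comp (C (1 + c) + C (υ : R) * X)
  have hP : P.natDegree ≤ n := natDegree_ascPochhammer_comp_linear_le _ _ _
  have hsum := sum_choose_mul_eval_mul_prod_sub P hP a
  have hPa : P.eval a = (ascPochhammer R n).eval (c + h - n) := by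
    simp only [P, eval_comp, eval_add, eval_mul, eval_C, eval_X, ha]
    congr 1; ring
  rw [hPa] at hsum
  have hz : ((υ : R) ^ n * (n.factorial : R) * (ascPochhammer R (υ * n)).eval (1 + c) *
        (ascPochhammer R n).eval (c + h - n)) = (υ : R) ^ n *
        (ascPochhammer R (υ * n)).eval (1 + c) * ((n.factorial : R) *
          (ascPochhammer R n).eval (c + h - n)) := by ring
  rw [hz, ← hsum, mul_sum, sum_smul, smul_sum]
  refine sum_congr rfl fun j hj => ?_
  have hjn : j ≤ n := Nat.lt_succ_iff.mp (mem_range.mp hj)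
  have hk : υ * j + n ≤ υ * n + n := Nat.add_le_add_right (Nat.mul_le_mul_left υ hjn) n
  have hprod : ∏ l ∈ (range (n + 1)).erase j, (n + 1 - h + (υ * l : ℕ)) =
      (-1) ^ n * (υ : R) ^ n * ∏ l ∈ (range (n + 1)).erase j, (a - l) := by
    have hcard : ((range (n + 1)).erase j).card = n := by rw [card_erase_of_mem hj]; simp
    have e : ∀ l : ℕ, (n + 1 - h + (υ * l : ℕ) : R) = (-1 * (υ : R)) * (a - l) := by
      intro l; push_cast; linear_combination ha
    rw [prod_congr rfl fun l _ => e l, prod_mul_distrib, prod_const, hcard, mul_pow]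
  have h1 : (ascPochhammer R (n - 1)).eval (2 - h) * (ascPochhammer R (υ * j)).eval (n + 1 - h) *
      (n + 1 - h + (υ * j : ℕ)) = (ascPochhammer R (υ * j + n)).eval (2 - h) := by
    have e1 := ascPochhammer_eval_add_index (2 - h) (n - 1) (υ * j)
    have e2 := ascPochhammer_eval_add_index (2 - h) (n - 1 + υ * j) 1
    obtain ⟨m, rfl⟩ : ∃ m, n = m + 1 := ⟨n - 1, by omega⟩
    have e3 : m + 1 - 1 + υ * j + 1 = υ * j + (m + 1) := by omega
    rw [e3, e1] at e2
    rw [e2, ascPochhammer_one, eval_X]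
    simp only [Nat.add_sub_cancel]; push_cast
    have e5 : (m : R) + 1 + 1 - h = 2 - h + m := by ring
    rw [e5]; ring
  have h2 : (ascPochhammer R (υ * (n - j))).eval (1 + c + (υ * j : ℕ)) *
      (ascPochhammer R (υ * j + n)).eval (1 + c) =
      (ascPochhammer R (υ * n)).eval (1 + c) * (ascPochhammer R n).eval (1 + c + (υ * j : ℕ)) := by
    have e1 := ascPochhammer_eval_add_index (1 + c) (υ * j) (υ * (n - j))
    rw [← Nat.mul_add, Nat.add_sub_cancel' hjn] at e1
    rw [e1, ascPochhammer_eval_add_index (1 + c) (υ * j) n]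
    ring
  have hs : (-1 : R) ^ (υ * j) * (-1) ^ (υ * j) = 1 := by rw [← mul_pow]; simp
  have hsj : (-1 : R) ^ n * (-1) ^ n = 1 := by rw [← mul_pow]; simp
  have hnj : (-1 : R) ^ n * (-1) ^ j = (-1) ^ (n - j) := by
    obtain ⟨t, rfl⟩ := Nat.exists_eq_add_of_le hjn
    have hs : (-1 : R) ^ j * (-1) ^ j = 1 := by rw [← mul_pow]; simp
    rw [Nat.add_sub_cancel_left, pow_add]
    linear_combination (-1 : R) ^ t * hs
  have hPe : P.eval (j : R) = (ascPochhammer R n).eval (1 + c + (υ * j : ℕ)) := by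
    simp only [P, eval_comp, eval_add, eval_mul, eval_C, eval_X]
    push_cast; rfl
  rw [smul_smul, ← mul_prod_erase _ _ hj, hprod]
  calc _ = ((-1) ^ (j + n) * (n.choose j : R) * (-1) ^ (υ * j) *
        (ascPochhammer R (υ * (n - j))).eval (1 + c + (υ * j : ℕ)) *
        ((-1) ^ n * (υ : R) ^ n * ∏ l ∈ (range (n + 1)).erase j, (a - l))) •
        ((ascPochhammer R (υ * j + n)).eval (2 - h) • J (υ * j + n)) := by
        rw [smul_smul, ← h1]
        congr 1
        ring
    _ = _ := by
        rw [hJ _ hk, smul_smul, hPe, ← hnj]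
        congr 1
        generalize (∏ l ∈ (range (n + 1)).erase j, (a - (l : R))) = D
        rw [pow_add (-1 : R) (υ * j) n, pow_add]
        calc _ = ((-1 : R) ^ (υ * j) * (-1) ^ (υ * j)) * ((-1 : R) ^ n * (-1) ^ n) *
            ((-1) ^ j * (-1) ^ n * (n.choose j : R) * (υ : R) ^ n * D) *
            ((ascPochhammer R (υ * (n - j))).eval (1 + c + (υ * j : ℕ)) *
              (ascPochhammer R (υ * j + n)).eval (1 + c)) := by ring
          _ = _ := by rw [hs, hsj, h2]; ring

/-- The relation `hK` replaces `(h+c-n)_s` by `(1+c+υi)_s`, after which the sum over `s` is a Newton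
series at `-(1+c+υi)`. The shift `1+c` cancels there and leaves `(-i)_n`. -/
theorem sum_sum_moments_eq [Algebra ℂ R] (c h : R) {υ n i : ℕ} (hυ : 1 ≤ υ)
    (K : ℕ → M) (hK : ∀ s ≤ n, (ascPochhammer R s).eval (h + c - n) • K s =
      (ascPochhammer R s).eval (1 + c + (υ * i : ℕ)) • K 0) :
    ∑ s ∈ range (n + 1), ∑ j ∈ range (s + 1),
      ((-1 : R) ^ (j + n) * algebraMap ℂ R (s.factorial : ℂ)⁻¹ * (s.choose j : R) *
        ((ascPochhammer R n).eval (algebraMap ℂ R (υ : ℂ)⁻¹ * (j + 1 + c)) *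
          (ascPochhammer R s).eval (h + c - n))) • K s =
      ((-1) ^ n * (ascPochhammer R n).eval (-(i : R))) • K 0 := by
  have hι : (υ : R) * algebraMap ℂ R (υ : ℂ)⁻¹ = 1 := by
    rw [← map_natCast (algebraMap ℂ R), ← map_mul, mul_inv_cancel₀, map_one]
    exact_mod_cast (by omega : υ ≠ 0)
  set ι := algebraMap ℂ R (υ : ℂ)⁻¹
  let P : R[X] := (ascPochhammer R n).comp (C (ι * (1 + c)) + C ι * X)
  have hP : P.natDegree ≤ n := natDegree_ascPochhammer_comp_linear_le _ _ _
  have hsum := newton_series_eval_neg P hP (1 + c + (υ * i : ℕ))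
  have hPa : P.eval (-(1 + c + (υ * i : ℕ))) = (ascPochhammer R n).eval (-(i : R)) := by
    simp only [P, eval_comp, eval_add, eval_mul, eval_C, eval_X]
    congr 1
    push_cast
    linear_combination -(i : R) * hι
  have hPe : ∀ j : ℕ, P.eval (j : R) = (ascPochhammer R n).eval (ι * (j + 1 + c)) := by
    intro j
    simp only [P, eval_comp, eval_add, eval_mul, eval_C, eval_X]
    congr 1
    ring
  rw [hPa] at hsum
  rw [← hsum, mul_sum, sum_smul]
  refine sum_congr rfl fun s hs => ?_
  rw [← sum_smul]
  calc _ = ((-1) ^ n * (algebraMap ℂ R (s.factorial : ℂ)⁻¹ *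
      ∑ j ∈ range (s + 1), (-1 : R) ^ j * (s.choose j : R) * P.eval (j : R))) •
        ((ascPochhammer R s).eval (h + c - n) • K s) := by
        rw [smul_smul, mul_sum, mul_sum, sum_mul]
        congr 1
        refine sum_congr rfl fun j _ => ?_
        rw [hPe, pow_add]; ring
    _ = _ := by
        rw [hK s (Nat.lt_succ_iff.mp (mem_range.mp hs)), smul_smul]
        congr 1; ring

end MomentIdentities

/-! ### Decay of matrix exponentials from spectral bounds -/

section MatrixExponentialGrowth

open Finset
open scoped Matrix.Norms.Operator

variable {p : ℕ}

theorem matrix_norm_le_sum_norm_mulVec_single (A : Matrix (Fin p) (Fin p) ℂ) :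
    ‖A‖ ≤ ∑ j, ‖A.mulVec (Pi.single j 1)‖ := by
  have h : (univ.sup fun i => ∑ j, ‖A i j‖₊) ≤ ∑ j, ‖A.mulVec (Pi.single j 1)‖₊ := by
    refine Finset.sup_le fun i _ => sum_le_sum fun j _ => ?_
    have := nnnorm_le_pi_nnnorm (A.mulVec (Pi.single j 1)) i
    simpa using this
  rw [Matrix.linfty_opNorm_def]
  refine (NNReal.coe_le_coe.mpr h).trans_eq ?_
  rw [NNReal.coe_sum]
  rfl

theorem hasSum_exp_mulVec (A : Matrix (Fin p) (Fin p) ℂ) (v : Fin p → ℂ) :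
    HasSum (fun n : ℕ => ((n.factorial : ℂ)⁻¹ • A ^ n).mulVec v)
      ((NormedSpace.exp A).mulVec v) := by
  have h := NormedSpace.exp_series_hasSum_exp' (𝕂 := ℂ) A
  have hc : Continuous fun M : Matrix (Fin p) (Fin p) ℂ => M.mulVec v :=
    continuous_id.matrix_mulVec continuous_const
  exact h.map (⟨⟨fun M => M.mulVec v, Matrix.zero_mulVec v⟩,
    fun M N => Matrix.add_mulVec M N v⟩ : Matrix (Fin p) (Fin p) ℂ →+ (Fin p → ℂ)) hc

theorem exp_mulVec_of_pow_mulVec_eq_zero {A : Matrix (Fin p) (Fin p) ℂ} {v : Fin p → ℂ} {k : ℕ}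
    (h : (A ^ k).mulVec v = 0) :
    (NormedSpace.exp A).mulVec v =
      ∑ n ∈ range k, (n.factorial : ℂ)⁻¹ • (A ^ n).mulVec v := by
  refine (hasSum_exp_mulVec A v).unique ?_
  simp only [Matrix.smul_mulVec]
  refine hasSum_sum_of_ne_finset_zero fun n hn => ?_
  obtain ⟨m, rfl⟩ := Nat.exists_eq_add_of_le (not_lt.mp fun hlt => hn (mem_range.mpr hlt))
  rw [add_comm, pow_add, ← Matrix.mulVec_mulVec, h, Matrix.mulVec_zero, smul_zero]

theorem exp_mulVec_of_mulVec_eq_smul {A : Matrix (Fin p) (Fin p) ℂ} {v : Fin p → ℂ} {α : ℂ}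
    (h : A.mulVec v = α • v) :
    (NormedSpace.exp A).mulVec v = Complex.exp α • v := by
  have hp : ∀ n : ℕ, (A ^ n).mulVec v = α ^ n • v := by
    intro n
    induction n with
    | zero => simp
    | succ n ih => rw [pow_succ, ← Matrix.mulVec_mulVec, h, Matrix.mulVec_smul, ih, smul_smul,
        pow_succ, mul_comm]
  refine (hasSum_exp_mulVec A v).unique ?_
  simp only [Matrix.smul_mulVec, hp, smul_smul]
  have := NormedSpace.exp_series_hasSum_exp' (𝕂 := ℂ) α
  rw [← Complex.exp_eq_exp_ℂ] at this
  exact this.smul_const v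

theorem exp_smul_mulVec_of_mem_genEigenspace {A : Matrix (Fin p) (Fin p) ℂ} {v : Fin p → ℂ}
    {μ : ℂ} {k : ℕ} (h : ((A - μ • 1) ^ k).mulVec v = 0) (s : ℂ) :
    (NormedSpace.exp (s • A)).mulVec v = Complex.exp (s * μ) •
      ∑ n ∈ range k, (s ^ n * (n.factorial : ℂ)⁻¹) • ((A - μ • 1) ^ n).mulVec v := by
  have hsplit : s • A = s • (A - μ • 1) + (s * μ) • (1 : Matrix (Fin p) (Fin p) ℂ) := by
    rw [smul_sub, smul_smul, sub_add_cancel]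
  rw [hsplit, Matrix.exp_add_of_commute _ _ ((Commute.one_right _).smul_right _),
    ← Matrix.mulVec_mulVec,
    exp_mulVec_of_mulVec_eq_smul (α := s * μ) (v := v)
      (by rw [Matrix.smul_mulVec, Matrix.one_mulVec]), Matrix.mulVec_smul]
  congr 1
  rw [exp_mulVec_of_pow_mulVec_eq_zero (k := k)]
  · refine sum_congr rfl fun n _ => ?_
    rw [smul_pow, Matrix.smul_mulVec, smul_smul, mul_comm]
  · rw [smul_pow, Matrix.smul_mulVec, h, smul_zero]

/-- Generalized eigenvectors span the space, and on each of them the exponential is `e^(-tμ)` times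
a polynomial in `t`. The gap `Re μ - a > 0` absorbs that polynomial. -/
theorem exists_norm_exp_neg_smul_mulVec_le {A : Matrix (Fin p) (Fin p) ℂ} {a : ℝ}
    (hA : ∀ z ∈ spectrum ℂ A, a < z.re) (v : Fin p → ℂ) :
    ∃ K : ℝ, ∀ t : ℝ, 0 ≤ t →
      ‖(NormedSpace.exp (((-t : ℝ) : ℂ) • A)).mulVec v‖ ≤ K * Real.exp (-a * t) := by
  have hv : v ∈ ⨆ μ, Module.End.maxGenEigenspace (Matrix.toLin' A) μ := by
    rw [Module.End.iSup_maxGenEigenspace_eq_top]; trivial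
  refine Submodule.iSup_induction _ (motive := fun v => ∃ K : ℝ, ∀ t : ℝ, 0 ≤ t →
    ‖(NormedSpace.exp (((-t : ℝ) : ℂ) • A)).mulVec v‖ ≤ K * Real.exp (-a * t)) hv ?_
    ⟨0, fun t _ => by simp⟩ ?_
  · intro μ x hx
    obtain ⟨k, hk⟩ := (Module.End.mem_maxGenEigenspace _ _ _).mp hx
    have hk' : ((A - μ • 1) ^ k).mulVec x = 0 := by
      have e : Matrix.toLin' A - μ • 1 = Matrix.toLin' (A - μ • 1) := by
        simp [Module.End.one_eq_id]
      rw [e, ← Matrix.toLin'_pow, Matrix.toLin'_apply] at hk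
      exact hk
    by_cases hμ : μ ∈ spectrum ℂ A
    · have hδ : 0 < μ.re - a := sub_pos.mpr (hA μ hμ)
      refine ⟨∑ n ∈ range k, ((μ.re - a) ^ n)⁻¹ * ‖((A - μ • 1) ^ n).mulVec x‖, fun t ht => ?_⟩
      rw [exp_smul_mulVec_of_mem_genEigenspace hk', norm_smul, Complex.norm_exp, sum_mul]
      refine (mul_le_mul_of_nonneg_left (norm_sum_le _ _) (Real.exp_nonneg _)).trans ?_
      rw [mul_sum]
      refine sum_le_sum fun n _ => ?_
      rw [norm_smul]
      have hn : ‖(((-t : ℝ) : ℂ)) ^ n * (n.factorial : ℂ)⁻¹‖ = t ^ n / n.factorial := by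
        rw [norm_mul, norm_pow, Complex.norm_real, norm_inv, Complex.norm_natCast, norm_neg,
          Real.norm_of_nonneg ht, div_eq_mul_inv]
      have hre : (((-t : ℝ) : ℂ) * μ).re = -t * μ.re := by
        rw [Complex.re_ofReal_mul]
      rw [hn, hre]
      have hb : t ^ n / n.factorial ≤ ((μ.re - a) ^ n)⁻¹ * Real.exp ((μ.re - a) * t) := by
        have := Real.pow_div_factorial_le_exp ((μ.re - a) * t) (by positivity) n
        rw [mul_pow, mul_div_assoc] at this
        rw [inv_mul_eq_div, le_div_iff₀ (by positivity), mul_comm]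
        exact this
      have he : Real.exp (-a * t) = Real.exp (-t * μ.re) * Real.exp ((μ.re - a) * t) := by
        rw [← Real.exp_add]; congr 1; ring
      rw [he]
      calc _ ≤ Real.exp (-t * μ.re) * (((μ.re - a) ^ n)⁻¹ * Real.exp ((μ.re - a) * t) *
            ‖((A - μ • 1) ^ n).mulVec x‖) := by gcongr
        _ = _ := by ring
    -- When `μ` is not an eigenvalue its generalized eigenspace is zero.
    · have hu : IsUnit (A - μ • 1) := by
        rw [spectrum.notMem_iff, Algebra.algebraMap_eq_smul_one] at hμ
        rw [← neg_sub]; exact hμ.neg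
      obtain ⟨B, hB⟩ := (hu.pow k).exists_left_inv
      have hx0 : x = 0 := by
        rw [← Matrix.one_mulVec x, ← hB, ← Matrix.mulVec_mulVec, hk', Matrix.mulVec_zero]
      exact ⟨0, fun t _ => by simp [hx0]⟩
  · rintro x y ⟨K, hK⟩ ⟨L, hL⟩
    refine ⟨K + L, fun t ht => ?_⟩
    rw [Matrix.mulVec_add, add_mul]
    exact (norm_add_le _ _).trans (add_le_add (hK t ht) (hL t ht))

theorem exists_norm_exp_neg_smul_le {A : Matrix (Fin p) (Fin p) ℂ} {a : ℝ}
    (hA : ∀ z ∈ spectrum ℂ A, a < z.re) :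
    ∃ K : ℝ, 0 ≤ K ∧ ∀ t : ℝ, 0 ≤ t →
      ‖NormedSpace.exp (((-t : ℝ) : ℂ) • A)‖ ≤ K * Real.exp (-a * t) := by
  choose K hK using fun j => exists_norm_exp_neg_smul_mulVec_le hA (Pi.single j 1)
  refine ⟨|∑ j, K j|, abs_nonneg _, fun t ht => ?_⟩
  refine (matrix_norm_le_sum_norm_mulVec_single _).trans ?_
  calc _ ≤ ∑ j, K j * Real.exp (-a * t) := sum_le_sum fun j _ => hK j t ht
    _ = (∑ j, K j) * Real.exp (-a * t) := by rw [sum_mul]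
    _ ≤ _ := by gcongr; exact le_abs_self _

theorem exists_lt_forall_lt_re {S : Set ℂ} (hS : S.Finite) {c d : ℝ} (hcd : c < d)
    (h : ∀ z ∈ S, c < z.re) : ∃ a, c < a ∧ a < d ∧ ∀ z ∈ S, a < z.re := by
  have h1 : ∀ᶠ a in nhdsWithin c (Set.Ioi c), ∀ z ∈ S, a < z.re :=
    (Set.Finite.eventually_all hS).mpr fun z hz =>
      (eventually_lt_nhds (h z hz)).filter_mono nhdsWithin_le_nhds
  have h2 : ∀ᶠ a in nhdsWithin c (Set.Ioi c), a < d :=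
    (eventually_lt_nhds hcd).filter_mono nhdsWithin_le_nhds
  obtain ⟨a, ⟨ha1, ha2⟩, ha3⟩ := ((h1.and h2).and self_mem_nhdsWithin).exists
  exact ⟨a, ha3, ha2, ha1⟩

end MatrixExponentialGrowth

/-! ### Bounds, integrability and recurrences for the weight moments -/

section WeightMoments

open Finset
open scoped Matrix.Norms.Operator

variable {p : ℕ}

/-- The continuous extended norm of the operator norm, for the entrywise topology of matrices. -/
noncomputable local instance matrixContinuousENorm :
    ContinuousENorm (Matrix (Fin p) (Fin p) ℂ) :=
  SeminormedAddGroup.toContinuousENorm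

local instance matrixPseudoMetrizableSpace :
    TopologicalSpace.PseudoMetrizableSpace (Matrix (Fin p) (Fin p) ℂ) :=
  inferInstanceAs (TopologicalSpace.PseudoMetrizableSpace (Fin p → Fin p → ℂ))

/-- This is `(u/(1+u))^C (1+u)^(-H)`: both exponentials now run over a nonnegative time, so the
decay bounds apply to each for every `u > 0`. -/
theorem matWeight_eq_exp_mul_exp {H C : Matrix (Fin p) (Fin p) ℂ} (hHC : H * C = C * H) (u : ℝ) :
    matWeight H C u = NormedSpace.exp (((-(Real.log (1 + u) - Real.log u) : ℝ) : ℂ) • C) *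
      NormedSpace.exp (((-Real.log (1 + u) : ℝ) : ℂ) • H) := by
  have hc : Commute H C := hHC
  rw [matWeight, matPow, matPow, ← Matrix.exp_add_of_commute, ← Matrix.exp_add_of_commute]
  · congr 1
    push_cast
    module
  · exact (hc.symm.smul_right _).smul_left _
  · exact (((hc.symm.add_right (Commute.refl C)).neg_right).smul_right _).smul_left _

theorem exists_norm_matWeight_le {H C : Matrix (Fin p) (Fin p) ℂ} (hHC : H * C = C * H)
    (hC : ∀ z ∈ spectrum ℂ C, -1 < z.re) {β : ℝ} (hβ : 0 ≤ β)
    (hH : ∀ x ∈ spectrum ℂ H, β < x.re) :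
    ∃ a b K : ℝ, -1 < a ∧ β < b ∧ 0 ≤ K ∧
      (∀ u : ℝ, 0 < u → u ≤ 1 → ‖matWeight H C u‖ ≤ K * u ^ a) ∧
      (∀ u : ℝ, 1 ≤ u → ‖matWeight H C u‖ ≤ K * u ^ (-b)) := by
  obtain ⟨a, ha, ha0, haC⟩ := exists_lt_forall_lt_re (Matrix.finite_spectrum C)
    (show (-1 : ℝ) < 0 by norm_num) hC
  obtain ⟨b, hb, -, hbH⟩ := exists_lt_forall_lt_re (Matrix.finite_spectrum H)
    (show β < β + 1 by linarith) hH
  obtain ⟨K, hK0, hK⟩ := exists_norm_exp_neg_smul_le haC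
  obtain ⟨L, hL0, hL⟩ := exists_norm_exp_neg_smul_le hbH
  have hmain : ∀ u : ℝ, 0 < u → ‖matWeight H C u‖ ≤
      K * L * ((u ^ a * (1 + u) ^ (-a)) * (1 + u) ^ (-b)) := by
    intro u hu
    have hlog : Real.log u ≤ Real.log (1 + u) := Real.log_le_log hu (by linarith)
    have h1 := hK (Real.log (1 + u) - Real.log u) (by linarith)
    have h2 := hL (Real.log (1 + u)) (Real.log_nonneg (by linarith))
    rw [matWeight_eq_exp_mul_exp hHC]
    refine (norm_mul_le _ _).trans ?_
    refine (mul_le_mul h1 h2 (norm_nonneg _) (by positivity)).trans_eq ?_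
    rw [Real.rpow_def_of_pos hu, Real.rpow_def_of_pos (by linarith), Real.rpow_def_of_pos
      (by linarith), ← Real.exp_add]
    have : -a * (Real.log (1 + u) - Real.log u) = Real.log u * a + Real.log (1 + u) * -a := by ring
    rw [this, mul_comm (-b)]
    ring
  -- The factor `2` works on both ranges since `-a < 1`: it bounds `(1+u)^(-a)` for `u ≤ 1` and
  -- `((1+u)/u)^(-a)` for `u ≥ 1`.
  refine ⟨a, b, K * L * 2, ha, hb, by positivity, fun u hu hu1 => ?_, fun u hu => ?_⟩
  · refine (hmain u hu).trans ?_
    have h1 : (1 + u) ^ (-a) ≤ 2 := by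
      calc (1 + u) ^ (-a) ≤ (1 + u) ^ (1 : ℝ) :=
            Real.rpow_le_rpow_of_exponent_le (by linarith) (by linarith)
        _ ≤ 2 := by rw [Real.rpow_one]; linarith
    have h2 : (1 + u) ^ (-b) ≤ 1 := Real.rpow_le_one_of_one_le_of_nonpos (by linarith) (by linarith)
    have h3 : 0 ≤ u ^ a := by positivity
    calc _ ≤ K * L * (u ^ a * 2 * 1) := by gcongr
      _ = _ := by ring
  · have hu0 : 0 < u := by linarith
    refine (hmain u hu0).trans ?_
    have h1 : u ^ a * (1 + u) ^ (-a) ≤ 2 := by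
      have e : u ^ a * (1 + u) ^ (-a) = ((1 + u) / u) ^ (-a) := by
        rw [Real.div_rpow (by linarith) hu0.le, Real.rpow_neg hu0.le a, div_inv_eq_mul, mul_comm]
      have h2 : (1 + u) / u ≤ 2 := by rw [div_le_iff₀ hu0]; linarith
      have h3 : 1 ≤ (1 + u) / u := by rw [le_div_iff₀ hu0]; linarith
      rw [e]
      calc ((1 + u) / u) ^ (-a) ≤ ((1 + u) / u) ^ (1 : ℝ) :=
            Real.rpow_le_rpow_of_exponent_le h3 (by linarith)
        _ ≤ 2 := by rw [Real.rpow_one]; exact h2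
    have h2 : (1 + u) ^ (-b) ≤ u ^ (-b) :=
      Real.rpow_le_rpow_of_nonpos hu0 (by linarith) (by linarith)
    calc _ ≤ K * L * (2 * u ^ (-b)) := by gcongr
      _ = _ := by ring

/-- The integrand `u ^ k (1 + u) ^ m W(u)`, where `W` is the matrix weight. -/
noncomputable def momentKernel (H C : Matrix (Fin p) (Fin p) ℂ) (k m : ℕ) (u : ℝ) :
    Matrix (Fin p) (Fin p) ℂ :=
  ((u : ℂ) ^ k * (1 + (u : ℂ)) ^ m) • matWeight H C u

/-- The matrix moment `∫ u ^ k (1 + u) ^ m W(u) du` over `(0, ∞)`. -/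
noncomputable def weightMoment (H C : Matrix (Fin p) (Fin p) ℂ) (k m : ℕ) :
    Matrix (Fin p) (Fin p) ℂ :=
  ∫ u in Set.Ioi (0 : ℝ), momentKernel H C k m u

theorem exists_norm_momentKernel_le {H C : Matrix (Fin p) (Fin p) ℂ} (hHC : H * C = C * H)
    (hC : ∀ z ∈ spectrum ℂ C, -1 < z.re) {β : ℝ} (hβ : 0 ≤ β)
    (hH : ∀ x ∈ spectrum ℂ H, β < x.re) (k m : ℕ) :
    ∃ a b K : ℝ, -1 < a ∧ β < b ∧
      (∀ u : ℝ, 0 < u → u ≤ 1 → ‖momentKernel H C k m u‖ ≤ K * u ^ (k + a)) ∧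
      (∀ u : ℝ, 1 ≤ u → ‖momentKernel H C k m u‖ ≤ K * u ^ (k + m - b)) := by
  obtain ⟨a, b, K, ha, hb, hK, h0, h1⟩ := exists_norm_matWeight_le hHC hC hβ hH
  have hn : ∀ u : ℝ, 0 < u → ‖momentKernel H C k m u‖ =
      u ^ k * (1 + u) ^ m * ‖matWeight H C u‖ := by
    intro u hu
    have e : (1 + (u : ℂ)) = ((1 + u : ℝ) : ℂ) := by push_cast; rfl
    rw [momentKernel, norm_smul, norm_mul, norm_pow, norm_pow, e, Complex.norm_real,
      Complex.norm_real, Real.norm_of_nonneg hu.le, Real.norm_of_nonneg (by linarith)]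
  refine ⟨a, b, 2 ^ m * K, ha, hb, fun u hu hu1 => ?_, fun u hu => ?_⟩
  · rw [hn u hu, Real.rpow_add hu, Real.rpow_natCast]
    have h2 : (1 + u) ^ m ≤ 2 ^ m := pow_le_pow_left₀ (by linarith) (by linarith) m
    calc _ ≤ u ^ k * 2 ^ m * (K * u ^ a) := by
          gcongr
          exact h0 u hu hu1
      _ = _ := by ring
  · have hu0 : 0 < u := by linarith
    rw [hn u hu0, sub_eq_add_neg, Real.rpow_add hu0, Real.rpow_add hu0, Real.rpow_natCast,
      Real.rpow_natCast]
    have h2 : (1 + u) ^ m ≤ (2 * u) ^ m := pow_le_pow_left₀ (by linarith) (by linarith) m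
    calc _ ≤ u ^ k * (2 * u) ^ m * (K * u ^ (-b)) := by
          gcongr
          exact h1 u hu
      _ = _ := by rw [mul_pow]; ring

theorem hasDerivAt_matPow (S : Matrix (Fin p) (Fin p) ℂ) {u : ℝ} (hu : 0 < u) :
    HasDerivAt (fun u => matPow u S) ((u : ℂ)⁻¹ • (S * matPow u S)) u := by
  have h := (hasDerivAt_exp_smul_const' (𝕂 := ℝ) S (Real.log u)).scomp u
    (Real.hasDerivAt_log hu.ne')
  have e : ∀ u : ℝ, matPow u S = NormedSpace.exp (Real.log u • S) := by
    intro u; rw [matPow, Complex.coe_smul]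
  simp only [e]
  have e2 : (u : ℂ)⁻¹ • (S * NormedSpace.exp (Real.log u • S)) =
      u⁻¹ • (S * NormedSpace.exp (Real.log u • S)) := by
    rw [← Complex.ofReal_inv, Complex.coe_smul]
  rw [e2]
  exact h

theorem commute_matPow_right {X S : Matrix (Fin p) (Fin p) ℂ} (h : Commute X S) (u : ℝ) :
    Commute X (matPow u S) :=
  (h.smul_right _).exp_right

theorem commute_matWeight {X H C : Matrix (Fin p) (Fin p) ℂ} (hH : Commute X H)
    (hC : Commute X C) (u : ℝ) : Commute X (matWeight H C u) :=
  (commute_matPow_right hC u).mul_right (commute_matPow_right (hH.add_right hC).neg_right _)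

theorem hasDerivAt_matWeight {H C : Matrix (Fin p) (Fin p) ℂ} (hHC : H * C = C * H) {u : ℝ}
    (hu : 0 < u) :
    HasDerivAt (matWeight H C) ((u : ℂ)⁻¹ • (C * matWeight H C u) -
      (1 + (u : ℂ))⁻¹ • ((H + C) * matWeight H C u)) u := by
  have h1 := hasDerivAt_matPow C hu
  have h2 := (hasDerivAt_matPow (-(H + C)) (show 0 < 1 + u by linarith)).scomp u
    ((hasDerivAt_id u).const_add 1)
  have h3 := h1.mul h2
  have hc : Commute (H + C) (matPow u C) :=
    commute_matPow_right ((show Commute H C from hHC).add_left (Commute.refl C)) u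
  refine h3.congr_deriv ?_
  simp only [matWeight, Function.comp, one_smul]
  rw [smul_mul_assoc, mul_smul_comm, neg_mul, mul_neg, mul_assoc, ← mul_assoc (matPow u C),
    ← mul_assoc (H + C), hc.eq, smul_neg, sub_eq_add_neg]
  push_cast
  rfl

theorem continuousOn_momentKernel {H C : Matrix (Fin p) (Fin p) ℂ} (hHC : H * C = C * H)
    (k m : ℕ) : ContinuousOn (momentKernel H C k m) (Set.Ioi 0) := by
  intro u hu
  have h1 : ContinuousAt (matWeight H C) u := (hasDerivAt_matWeight hHC hu).continuousAt
  have h2 : ContinuousAt (fun u : ℝ => (u : ℂ) ^ k * (1 + (u : ℂ)) ^ m) u := by fun_prop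
  exact (h2.smul h1).continuousWithinAt

theorem integrableOn_momentKernel {H C : Matrix (Fin p) (Fin p) ℂ} (hHC : H * C = C * H)
    (hC : ∀ z ∈ spectrum ℂ C, -1 < z.re) {k m : ℕ}
    (hH : ∀ x ∈ spectrum ℂ H, (k : ℝ) + m + 1 < x.re) :
    IntegrableOn (momentKernel H C k m) (Set.Ioi 0) := by
  obtain ⟨a, b, K, ha, hb, h0, h1⟩ := exists_norm_momentKernel_le hHC hC (by positivity) hH k m
  have hcont := continuousOn_momentKernel hHC k m
  rw [← Set.Ioc_union_Ioi_eq_Ioi (zero_le_one : (0 : ℝ) ≤ 1)]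
  refine IntegrableOn.union ?_ ?_
  · have hi : IntegrableOn (fun u : ℝ => K * u ^ ((k : ℝ) + a)) (Set.Ioc 0 1) := by
      rw [integrableOn_Ioc_iff_integrableOn_Ioo]
      refine Integrable.const_mul ?_ K
      exact (intervalIntegral.integrableOn_Ioo_rpow_iff one_pos).mpr
        (by have : (0 : ℝ) ≤ k := by positivity
            linarith)
    refine Integrable.mono' hi ((hcont.mono Set.Ioc_subset_Ioi_self).aestronglyMeasurable
      measurableSet_Ioc) ?_
    filter_upwards [ae_restrict_mem measurableSet_Ioc] with u hu using h0 u hu.1 hu.2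
  · have hi : IntegrableOn (fun u : ℝ => K * u ^ ((k : ℝ) + m - b)) (Set.Ioi 1) :=
      Integrable.const_mul (integrableOn_Ioi_rpow_of_lt (by linarith) one_pos) K
    refine Integrable.mono' hi ((hcont.mono (Set.Ioi_subset_Ioi zero_le_one)).aestronglyMeasurable
      measurableSet_Ioi) ?_
    filter_upwards [ae_restrict_mem measurableSet_Ioi] with u hu using h1 u (le_of_lt hu)

theorem hasDerivAt_momentKernel_succ_succ {H C : Matrix (Fin p) (Fin p) ℂ} (hHC : H * C = C * H)
    (k m : ℕ) {u : ℝ} (hu : 0 < u) :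
    HasDerivAt (momentKernel H C (k + 1) (m + 1))
      ((C + ((k : ℂ) + 1) • 1) * momentKernel H C k (m + 1) u -
        (H + C - ((m : ℂ) + 1) • 1) * momentKernel H C (k + 1) m u) u := by
  have hu0 : (u : ℂ) ≠ 0 := by exact_mod_cast hu.ne'
  have hu1 : 1 + (u : ℂ) ≠ 0 := by
    have : (1 + u : ℝ) ≠ 0 := by linarith
    exact_mod_cast this
  have hid : HasDerivAt (fun u : ℝ => (u : ℂ)) 1 u := Complex.ofRealCLM.hasDerivAt
  have h1 := (hid.pow (k + 1)).mul ((hid.const_add 1).pow (m + 1))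
  have h2 := h1.smul (hasDerivAt_matWeight hHC hu)
  refine h2.congr_deriv ?_
  simp only [momentKernel, Pi.mul_apply, Pi.pow_apply, Nat.add_sub_cancel, mul_one, add_mul,
    sub_mul, smul_mul_assoc, one_mul, mul_smul_comm, smul_sub, smul_smul, smul_add]
  push_cast
  match_scalars <;> field_simp <;> ring

/-- The derivative of `u^(k+1) (1+u)^(m+1) W` integrates to zero: the function is `O(u^(k+1+a))` at
`0` with `a > -1`, and `O(u^(k+m+2-b))` at infinity with `b > k+m+2`. -/
theorem weightMoment_recurrence {H C : Matrix (Fin p) (Fin p) ℂ} (hHC : H * C = C * H)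
    (hC : ∀ z ∈ spectrum ℂ C, -1 < z.re) {k m : ℕ}
    (hH : ∀ x ∈ spectrum ℂ H, (k : ℝ) + m + 2 < x.re) :
    (C + ((k : ℂ) + 1) • 1) * weightMoment H C k (m + 1) =
      (H + C - ((m : ℂ) + 1) • 1) * weightMoment H C (k + 1) m := by
  have hi1 : IntegrableOn (momentKernel H C k (m + 1)) (Set.Ioi 0) :=
    integrableOn_momentKernel hHC hC fun x hx => by
      have := hH x hx; push_cast; linarith
  have hi2 : IntegrableOn (momentKernel H C (k + 1) m) (Set.Ioi 0) :=
    integrableOn_momentKernel hHC hC fun x hx => by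
      have := hH x hx; push_cast; linarith
  obtain ⟨a, b, K, ha, hb, h0, h1⟩ :=
    exists_norm_momentKernel_le hHC hC (by positivity) hH (k + 1) (m + 1)
  have hz : momentKernel H C (k + 1) (m + 1) 0 = 0 := by simp [momentKernel]
  have hcont : ContinuousWithinAt (momentKernel H C (k + 1) (m + 1)) (Set.Ici 0) 0 := by
    rw [← continuousWithinAt_Ioi_iff_Ici, ContinuousWithinAt, hz]
    refine squeeze_zero_norm' (a := fun u : ℝ => K * u ^ (((k + 1 : ℕ) : ℝ) + a)) ?_ ?_
    · filter_upwards [Ioc_mem_nhdsGT (zero_lt_one : (0 : ℝ) < 1)] with u hu using h0 u hu.1 hu.2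
    · have hpos : 0 < ((k + 1 : ℕ) : ℝ) + a := by
        push_cast; have : (0 : ℝ) ≤ k := by positivity
        linarith
      have := ((Real.continuousAt_rpow_const 0 _ (Or.inr hpos.le)).tendsto.const_mul K).mono_left
        (nhdsWithin_le_nhds (s := Set.Ioi 0))
      rwa [Real.zero_rpow hpos.ne', mul_zero] at this
  have htop : Filter.Tendsto (momentKernel H C (k + 1) (m + 1)) Filter.atTop (nhds 0) := by
    refine squeeze_zero_norm' (a := fun u : ℝ => K * u ^ (((k + 1 : ℕ) : ℝ) + (m + 1 : ℕ) - b)) ?_ ?_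
    · filter_upwards [Filter.eventually_ge_atTop 1] with u hu using h1 u hu
    · have := (tendsto_rpow_neg_atTop (y := b - (((k + 1 : ℕ) : ℝ) + (m + 1 : ℕ)))
        (by push_cast; linarith)).const_mul K
      rwa [mul_zero, neg_sub] at this
  have hi : IntegrableOn (fun u => (C + ((k : ℂ) + 1) • 1) * momentKernel H C k (m + 1) u -
      (H + C - ((m : ℂ) + 1) • 1) * momentKernel H C (k + 1) m u) (Set.Ioi 0) :=
    (hi1.const_mul _).sub (hi2.const_mul _)
  have := integral_Ioi_of_hasDerivAt_of_tendsto hcont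
    (fun u hu => hasDerivAt_momentKernel_succ_succ hHC k m hu) hi htop
  rw [hz, sub_zero, integral_sub (hi1.const_mul _) (hi2.const_mul _),
    integral_const_mul_of_integrable hi1, integral_const_mul_of_integrable hi2] at this
  exact sub_eq_zero.mp this

theorem weightMoment_add_one_right {H C : Matrix (Fin p) (Fin p) ℂ} (hHC : H * C = C * H)
    (hC : ∀ z ∈ spectrum ℂ C, -1 < z.re) {k m : ℕ}
    (hH : ∀ x ∈ spectrum ℂ H, (k : ℝ) + m + 2 < x.re) :
    weightMoment H C k (m + 1) = weightMoment H C k m + weightMoment H C (k + 1) m := by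
  have hi1 : IntegrableOn (momentKernel H C k m) (Set.Ioi 0) :=
    integrableOn_momentKernel hHC hC fun x hx => by
      have := hH x hx; linarith
  have hi2 : IntegrableOn (momentKernel H C (k + 1) m) (Set.Ioi 0) :=
    integrableOn_momentKernel hHC hC fun x hx => by
      have := hH x hx; push_cast; linarith
  rw [weightMoment, weightMoment, weightMoment, ← integral_add hi1 hi2]
  refine integral_congr_ae (Filter.Eventually.of_forall fun u => ?_)
  simp only [momentKernel]
  rw [← add_smul]
  congr 1
  ring

theorem weightMoment_zero_recurrence {H C : Matrix (Fin p) (Fin p) ℂ} (hHC : H * C = C * H)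
    (hC : ∀ z ∈ spectrum ℂ C, -1 < z.re) {k : ℕ}
    (hH : ∀ x ∈ spectrum ℂ H, (k : ℝ) + 2 < x.re) :
    (C + ((k : ℂ) + 1) • 1) * weightMoment H C k 0 =
      (H - ((k : ℂ) + 2) • 1) * weightMoment H C (k + 1) 0 := by
  have hH' : ∀ x ∈ spectrum ℂ H, (k : ℝ) + (0 : ℕ) + 2 < x.re := by simpa using hH
  have h1 := weightMoment_recurrence hHC hC hH'
  rw [weightMoment_add_one_right hHC hC hH', mul_add] at h1
  rw [← eq_sub_iff_add_eq] at h1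
  rw [h1, ← sub_mul]
  congr 1
  push_cast
  module

end WeightMoments

/-! ### The Beta integral on the half-line -/

section ScalarBeta

theorem image_div_one_add_Ioi :
    (fun u : ℝ => u / (1 + u)) '' Set.Ioi 0 = Set.Ioo 0 1 := by
  ext x
  constructor
  · rintro ⟨u, hu, rfl⟩
    have hu' : 0 < u := hu
    exact ⟨by positivity, by rw [div_lt_one (by linarith)]; linarith⟩
  · rintro ⟨h0, h1⟩
    have h2 : 1 - x ≠ 0 := by linarith
    refine ⟨x / (1 - x), div_pos h0 (by linarith), ?_⟩
    have h3 : 1 + x / (1 - x) = 1 / (1 - x) := by field_simp; ring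
    simp only [h3]
    field_simp

/-- Substitution `x = u/(1+u)`, with `1-x = 1/(1+u)` and `dx = (1+u)^(-2) du`. -/
theorem integral_Ioi_eq_betaIntegral (α β : ℂ) :
    ∫ u in Set.Ioi (0 : ℝ), Complex.exp ((Real.log u : ℝ) * (α - 1)) *
      Complex.exp ((Real.log (1 + u) : ℝ) * -(α + β)) = Complex.betaIntegral α β := by
  have hderiv : ∀ u ∈ Set.Ioi (0 : ℝ), HasDerivWithinAt (fun u : ℝ => u / (1 + u))
      (1 / (1 + u) ^ 2) (Set.Ioi 0) u := by
    intro u hu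
    have hu' : 0 < u := hu
    have h := (hasDerivAt_id u).div ((hasDerivAt_id u).const_add 1) (by simp; linarith)
    refine (h.congr_deriv ?_).hasDerivWithinAt
    simp
  have hinj : Set.InjOn (fun u : ℝ => u / (1 + u)) (Set.Ioi 0) := by
    intro u hu w hw h
    have hu' : 0 < u := hu
    have hw' : 0 < w := hw
    simp only at h
    rw [div_eq_div_iff (by linarith) (by linarith)] at h
    linarith
  rw [Complex.betaIntegral, intervalIntegral.integral_of_le zero_le_one,
    integral_Ioc_eq_integral_Ioo, ← image_div_one_add_Ioi,
    integral_image_eq_integral_abs_deriv_smul measurableSet_Ioi hderiv hinj]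
  refine setIntegral_congr_fun measurableSet_Ioi fun u hu => ?_
  have hu0 : 0 < u := hu
  have hu1 : 0 < 1 + u := by linarith
  have hx : 0 < u / (1 + u) := by positivity
  have hy : 1 - u / (1 + u) = (1 + u)⁻¹ := by field_simp; ring
  have hyc : (1 : ℂ) - ((u / (1 + u) : ℝ) : ℂ) = (((1 + u)⁻¹ : ℝ) : ℂ) := by
    rw [← hy]; push_cast; rfl
  have hd : |1 / (1 + u) ^ 2| = Real.exp (-2 * Real.log (1 + u)) := by
    rw [abs_of_pos (by positivity), ← Real.log_rpow hu1, Real.exp_log (by positivity),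
      Real.rpow_neg hu1.le, one_div]
    norm_cast
  rw [hyc, Complex.cpow_def_of_ne_zero (by exact_mod_cast hx.ne'), Complex.cpow_def_of_ne_zero
    (by exact_mod_cast (inv_pos.mpr hu1).ne'), ← Complex.ofReal_log hx.le, ← Complex.ofReal_log
    (inv_pos.mpr hu1).le, hd, Real.log_div hu0.ne' hu1.ne', Real.log_inv, Complex.real_smul,
    Complex.ofReal_exp, ← Complex.exp_add, ← Complex.exp_add, ← Complex.exp_add]
  congr 1
  push_cast
  ring

theorem betaIntegral_ne_zero {α β : ℂ} (hα : 0 < α.re) (hβ : 0 < β.re) :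
    Complex.betaIntegral α β ≠ 0 := by
  intro h
  have := Complex.Gamma_mul_Gamma_eq_betaIntegral hα hβ
  rw [h, mul_zero] at this
  exact mul_ne_zero (Complex.Gamma_ne_zero_of_re_pos hα) (Complex.Gamma_ne_zero_of_re_pos hβ) this

end ScalarBeta

/-! ### Joint eigenvectors and invertibility of Pochhammer symbols -/

section JointEigenvector

variable {p : ℕ}

theorem mem_spectrum_of_mulVec_eq_smul {A : Matrix (Fin p) (Fin p) ℂ} {v : Fin p → ℂ} {α : ℂ}
    (hv : v ≠ 0) (h : A.mulVec v = α • v) : α ∈ spectrum ℂ A := by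
  rw [spectrum.mem_iff, Algebra.algebraMap_eq_smul_one]
  intro hu
  obtain ⟨B, hB⟩ := hu.exists_left_inv
  apply hv
  rw [← Matrix.one_mulVec v, ← hB, ← Matrix.mulVec_mulVec, Matrix.sub_mulVec, h,
    Matrix.smul_mulVec, Matrix.one_mulVec, sub_self, Matrix.mulVec_zero]

/-- An eigenspace of `C` is stable under the commuting `H`, whose restriction to it has an
eigenvector. -/
theorem exists_joint_eigenvector (hp : 1 ≤ p) {H C : Matrix (Fin p) (Fin p) ℂ}
    (hHC : H * C = C * H) :
    ∃ (v : Fin p → ℂ) (c h : ℂ), v ≠ 0 ∧ C.mulVec v = c • v ∧ H.mulVec v = h • v := by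
  have : Nonempty (Fin p) := ⟨⟨0, hp⟩⟩
  obtain ⟨c, hc⟩ := Module.End.exists_eigenvalue (Matrix.toLin' C)
  let E := Module.End.eigenspace (Matrix.toLin' C) c
  have hmaps : ∀ x ∈ E, Matrix.toLin' H x ∈ E := by
    intro x hx
    rw [Module.End.mem_eigenspace_iff] at hx ⊢
    rw [Matrix.toLin'_apply] at hx
    rw [Matrix.toLin'_apply, Matrix.toLin'_apply, Matrix.mulVec_mulVec, ← hHC,
      ← Matrix.mulVec_mulVec, hx, Matrix.mulVec_smul]
  have : Nontrivial E := Submodule.nontrivial_iff_ne_bot.mpr hc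
  obtain ⟨h, hh⟩ := Module.End.exists_eigenvalue ((Matrix.toLin' H).restrict hmaps)
  obtain ⟨w, hw⟩ := hh.exists_hasEigenvector
  refine ⟨w, c, h, fun h0 => hw.2 (Subtype.ext h0), ?_, ?_⟩
  · have := Module.End.mem_eigenspace_iff.mp w.2
    rwa [Matrix.toLin'_apply] at this
  · have := congrArg Subtype.val hw.apply_eq_smul
    simpa using this

theorem matPoch_mulVec_of_mulVec_eq_smul {A : Matrix (Fin p) (Fin p) ℂ} {v : Fin p → ℂ} {α : ℂ}
    (h : A.mulVec v = α • v) (k : ℕ) :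
    (matPoch A k).mulVec v = (ascPochhammer ℂ k).eval α • v := by
  induction k with
  | zero => simp [matPoch_zero]
  | succ k ih =>
    rw [matPoch_succ, ← Matrix.mulVec_mulVec, Matrix.add_mulVec, h, Matrix.smul_mulVec,
      Matrix.one_mulVec, ← add_smul, Matrix.mulVec_smul, ih, smul_smul, ascPochhammer_succ_eval,
      mul_comm]

theorem isUnit_matPoch {A : Matrix (Fin p) (Fin p) ℂ} {k : ℕ}
    (h : ∀ j < k, -(j : ℂ) ∉ spectrum ℂ A) : IsUnit (matPoch A k) := by
  induction k with
  | zero => rw [matPoch_zero]; exact isUnit_one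
  | succ k ih =>
    rw [matPoch_succ]
    refine (ih fun j hj => h j (Nat.lt_succ_of_lt hj)).mul ?_
    have := spectrum.notMem_iff.mp (h k (Nat.lt_succ_self k))
    rw [Algebra.algebraMap_eq_smul_one, ← IsUnit.neg_iff] at this
    convert this using 1
    module

theorem ascPochhammer_eval_ne_zero {a : ℂ} (ha : 0 < a.re) (k : ℕ) :
    (ascPochhammer ℂ k).eval a ≠ 0 := by
  rw [Ne, ascPochhammer_eval_eq_zero_iff]
  rintro ⟨j, -, hj⟩
  have := congrArg Complex.re hj
  simp at this
  have : (0 : ℝ) ≤ j := by positivity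
  linarith

end JointEigenvector

/-! ### Moments acting on a joint eigenvector -/

section MomentNonvanishing

open scoped Matrix.Norms.Operator

variable {p : ℕ}

attribute [local instance] matrixContinuousENorm matrixPseudoMetrizableSpace

theorem weightMoment_mulVec {H C : Matrix (Fin p) (Fin p) ℂ} {v : Fin p → ℂ} {c h : ℂ}
    {k m : ℕ} (hi : IntegrableOn (momentKernel H C k m) (Set.Ioi 0))
    (hcv : C.mulVec v = c • v) (hhv : H.mulVec v = h • v) :
    (weightMoment H C k m).mulVec v = Complex.betaIntegral (c + k + 1) (h - m - k - 1) • v := by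
  let L : Matrix (Fin p) (Fin p) ℂ →L[ℂ] (Fin p → ℂ) := LinearMap.toContinuousLinearMap
    { toFun := fun M => M.mulVec v
      map_add' := fun M N => Matrix.add_mulVec M N v
      map_smul' := fun a M => Matrix.smul_mulVec a M v }
  have hL := L.integral_comp_comm hi
  have e : (weightMoment H C k m).mulVec v = L (∫ u in Set.Ioi (0 : ℝ), momentKernel H C k m u) :=
    rfl
  refine e.trans (hL.symm.trans ?_)
  rw [← integral_Ioi_eq_betaIntegral, ← integral_smul_const]
  refine setIntegral_congr_fun measurableSet_Ioi fun u hu => ?_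
  have hu0 : 0 < u := hu
  have hu1 : 0 < 1 + u := by linarith
  have h1 : (matPow u C).mulVec v = Complex.exp ((Real.log u : ℝ) * c) • v := by
    refine exp_mulVec_of_mulVec_eq_smul ?_
    rw [Matrix.smul_mulVec, hcv, smul_smul]
  have h2 : (matPow (1 + u) (-(H + C))).mulVec v =
      Complex.exp ((Real.log (1 + u) : ℝ) * -(h + c)) • v := by
    refine exp_mulVec_of_mulVec_eq_smul ?_
    rw [Matrix.smul_mulVec, Matrix.neg_mulVec, Matrix.add_mulVec, hhv, hcv, ← add_smul, ← neg_smul,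
      smul_smul]
  have e1 : (u : ℂ) ^ k = Complex.exp ((Real.log u : ℝ) * k) := by
    rw [mul_comm, Complex.exp_nat_mul, ← Complex.ofReal_exp, Real.exp_log hu0]
  have e2 : (1 + (u : ℂ)) ^ m = Complex.exp ((Real.log (1 + u) : ℝ) * m) := by
    rw [mul_comm, Complex.exp_nat_mul, ← Complex.ofReal_exp, Real.exp_log hu1]
    push_cast; rfl
  change (((u : ℂ) ^ k * (1 + (u : ℂ)) ^ m) • (matPow u C * matPow (1 + u) (-(H + C)))).mulVec v = _
  rw [Matrix.smul_mulVec, ← Matrix.mulVec_mulVec, h2, Matrix.mulVec_smul, h1, smul_smul, smul_smul,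
    e1, e2]
  congr 1
  simp only [← Complex.exp_add]
  congr 1
  ring

theorem weightMoment_mulVec_ne_zero {H C : Matrix (Fin p) (Fin p) ℂ} (hHC : H * C = C * H)
    (hC : ∀ z ∈ spectrum ℂ C, -1 < z.re) {k m : ℕ}
    (hH : ∀ x ∈ spectrum ℂ H, (k : ℝ) + m + 1 < x.re) {v : Fin p → ℂ} (hv : v ≠ 0) {c h : ℂ}
    (hcv : C.mulVec v = c • v) (hhv : H.mulVec v = h • v) :
    (weightMoment H C k m).mulVec v = Complex.betaIntegral (c + k + 1) (h - m - k - 1) • v ∧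
      Complex.betaIntegral (c + k + 1) (h - m - k - 1) ≠ 0 := by
  refine ⟨weightMoment_mulVec (integrableOn_momentKernel hHC hC hH) hcv hhv, ?_⟩
  have h1 := hC c (mem_spectrum_of_mulVec_eq_smul hv hcv)
  have h2 := hH h (mem_spectrum_of_mulVec_eq_smul hv hhv)
  refine betaIntegral_ne_zero ?_ ?_
  · have : (0 : ℝ) ≤ k := by positivity
    simp; linarith
  · simp; linarith

end MomentNonvanishing

/-! ### From Bochner integrals to entrywise integrals -/

section EntrywiseIntegrals

open scoped Matrix.Norms.Operator

variable {p : ℕ}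

attribute [local instance] matrixContinuousENorm matrixPseudoMetrizableSpace

theorem integrableOn_entry {F : ℝ → Matrix (Fin p) (Fin p) ℂ} {S : Set ℝ}
    (hF : IntegrableOn F S) (a b : Fin p) :
    IntegrableOn (fun u => F u a b) S ∧ ∫ u in S, F u a b = (∫ u in S, F u) a b := by
  let L : Matrix (Fin p) (Fin p) ℂ →L[ℂ] ℂ := LinearMap.toContinuousLinearMap
    { toFun := fun M => M a b
      map_add' := fun _ _ => rfl
      map_smul' := fun _ _ => rfl }
  exact ⟨L.integrable_comp hF, L.integral_comp_comm hF⟩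

theorem matIntegrable_and_matIntegral_eq_sum {H C : Matrix (Fin p) (Fin p) ℂ}
    {F : ℝ → Matrix (Fin p) (Fin p) ℂ} (T : Finset ℕ) (X : ℕ → Matrix (Fin p) (Fin p) ℂ)
    (k m : ℕ → ℕ) (hF : ∀ u, F u = ∑ t ∈ T, X t * momentKernel H C (k t) (m t) u)
    (hi : ∀ t ∈ T, IntegrableOn (momentKernel H C (k t) (m t)) (Set.Ioi 0)) :
    MatIntegrable F ∧ matIntegral F = ∑ t ∈ T, X t * weightMoment H C (k t) (m t) := by
  have hFe : F = fun u => ∑ t ∈ T, X t * momentKernel H C (k t) (m t) u := funext hF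
  have hint : IntegrableOn F (Set.Ioi 0) := by
    rw [hFe]
    exact integrable_finsetSum T fun t ht => (hi t ht).const_mul (X t)
  have hval : ∫ u in Set.Ioi (0 : ℝ), F u = ∑ t ∈ T, X t * weightMoment H C (k t) (m t) := by
    rw [hFe, integral_finsetSum T fun t ht => (hi t ht).const_mul (X t)]
    exact Finset.sum_congr rfl fun t ht => integral_const_mul_of_integrable (hi t ht)
  refine ⟨fun a b => (integrableOn_entry hint a b).1, ?_⟩
  rw [← hval]
  ext a b
  exact (integrableOn_entry hint a b).2

end EntrywiseIntegrals

/-! ### Iterated recurrences and passage to a commutative algebra -/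

section MomentRelations

variable {p : ℕ}

theorem commute_matPoch {X S : Matrix (Fin p) (Fin p) ℂ} (h : Commute X S) (k : ℕ) :
    Commute X (matPoch S k) := by
  induction k with
  | zero => rw [matPoch_zero]; exact Commute.one_right X
  | succ k ih =>
    rw [matPoch_succ]
    exact ih.mul_right (h.add_right ((Commute.one_right X).smul_right _))

theorem matPoch_mul_weightMoment_zero {H C : Matrix (Fin p) (Fin p) ℂ} (hHC : H * C = C * H)
    (hC : ∀ z ∈ spectrum ℂ C, -1 < z.re) {k : ℕ}
    (hH : ∀ x ∈ spectrum ℂ H, (k : ℝ) + 1 < x.re) :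
    matPoch (2 - H) k * weightMoment H C k 0 =
      (-1) ^ k * matPoch (1 + C) k * weightMoment H C 0 0 := by
  induction k with
  | zero => simp [matPoch_zero]
  | succ k ih =>
    have hrec := weightMoment_zero_recurrence hHC hC (k := k) fun x hx => by
      have := hH x hx; push_cast at this; linarith
    have ih' := ih fun x hx => by have := hH x hx; push_cast at this; linarith
    have hc : Commute (C + ((k : ℂ) + 1) • 1) (matPoch (2 - H) k) := by
      refine commute_matPoch ?_ k
      refine Commute.add_left ?_ ((Commute.one_left _).smul_left _)
      exact (Commute.ofNat_right C 2).sub_right (show Commute H C from hHC).symm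
    have hc2 : Commute (C + ((k : ℂ) + 1) • 1) (matPoch (1 + C) k) := by
      refine commute_matPoch ?_ k
      refine Commute.add_left ?_ ((Commute.one_left _).smul_left _)
      exact (Commute.one_right C).add_right (Commute.refl C)
    have e1 : (2 : Matrix (Fin p) (Fin p) ℂ) - H + (k : ℂ) • 1 = -(H - ((k : ℂ) + 2) • 1) := by
      rw [add_smul, show (2 : ℂ) • (1 : Matrix (Fin p) (Fin p) ℂ) = 2 by
        rw [← Algebra.algebraMap_eq_smul_one, map_ofNat]]
      abel
    have e2 : (1 : Matrix (Fin p) (Fin p) ℂ) + C + (k : ℂ) • 1 = C + ((k : ℂ) + 1) • 1 := by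
      module
    have hc1 : Commute (C + ((k : ℂ) + 1) • 1) ((-1) ^ k) :=
      (Commute.one_right _).neg_right.pow_right k
    rw [matPoch_succ, matPoch_succ, e1, e2, mul_assoc, neg_mul, ← hrec, mul_neg, ← mul_assoc,
      ← hc.eq, mul_assoc, ih', ← hc2.eq, pow_succ, ← mul_assoc, ← mul_assoc, hc1.eq]
    simp only [mul_neg, mul_one, neg_mul, ← mul_assoc]

/-- Each use of the recurrence trades one factor `1+u` for one factor `u`, keeping the total degree
`k + n`, so a single spectral bound covers every step. -/
theorem matPoch_mul_weightMoment {H C : Matrix (Fin p) (Fin p) ℂ} (hHC : H * C = C * H)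
    (hC : ∀ z ∈ spectrum ℂ C, -1 < z.re) {k n : ℕ}
    (hH : ∀ x ∈ spectrum ℂ H, (k : ℝ) + n + 1 < x.re) {s : ℕ} (hs : s ≤ n) :
    matPoch (H + C - (n : ℂ) • 1) s * weightMoment H C (k + s) (n - s) =
      matPoch (1 + C + (k : ℂ) • 1) s * weightMoment H C k n := by
  induction s with
  | zero => simp [matPoch_zero]
  | succ s ih =>
    obtain ⟨m, rfl⟩ : ∃ m, n = s + 1 + m := ⟨n - (s + 1), by omega⟩
    have hrec := weightMoment_recurrence hHC hC (k := k + s) (m := m) fun x hx => by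
      have := hH x hx; push_cast at this ⊢; linarith
    have ih' := ih (by omega)
    have e0 : s + 1 + m - s = m + 1 := by omega
    have e0' : s + 1 + m - (s + 1) = m := by omega
    rw [e0] at ih'
    rw [e0']
    have hHC' : Commute H C := hHC
    have hc : Commute (C + (((k + s : ℕ) : ℂ) + 1) • 1)
        (matPoch (H + C - ((s + 1 + m : ℕ) : ℂ) • 1) s) := by
      refine commute_matPoch ?_ s
      refine Commute.add_left ?_ ((Commute.one_left _).smul_left _)
      exact (hHC'.symm.add_right (Commute.refl C)).sub_right ((Commute.one_right _).smul_right _)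
    have hc2 : Commute (C + (((k + s : ℕ) : ℂ) + 1) • 1) (matPoch (1 + C + (k : ℂ) • 1) s) := by
      refine commute_matPoch ?_ s
      refine Commute.add_left ?_ ((Commute.one_left _).smul_left _)
      exact ((Commute.one_right C).add_right (Commute.refl C)).add_right
        ((Commute.one_right _).smul_right _)
    have e1 : H + C - ((s + 1 + m : ℕ) : ℂ) • (1 : Matrix (Fin p) (Fin p) ℂ) + (s : ℂ) • 1 =
        H + C - ((m : ℂ) + 1) • 1 := by
      push_cast; module
    have e2 : (1 : Matrix (Fin p) (Fin p) ℂ) + C + (k : ℂ) • 1 + (s : ℂ) • 1 =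
        C + (((k + s : ℕ) : ℂ) + 1) • 1 := by
      push_cast; module
    rw [matPoch_succ, matPoch_succ, e1, e2, mul_assoc, ← add_assoc, ← hrec, ← mul_assoc, ← hc.eq,
      mul_assoc, ih', ← mul_assoc, hc2.eq]

open scoped IsMulCommutative in
theorem exists_commRing_algHom {H C : Matrix (Fin p) (Fin p) ℂ} (hHC : H * C = C * H) :
    ∃ (R : Type) (_ : CommRing R) (_ : Algebra ℂ R) (φ : R →ₐ[ℂ] Matrix (Fin p) (Fin p) ℂ)
      (c h : R), φ c = C ∧ φ h = H := by
  have hcomm : ∀ a ∈ ({H, C} : Set (Matrix (Fin p) (Fin p) ℂ)), ∀ b ∈ ({H, C} : Set _),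
      a * b = b * a := by
    rintro a (rfl | rfl) b (rfl | rfl)
    · rfl
    · exact hHC
    · exact hHC.symm
    · rfl
  have := Algebra.isMulCommutative_adjoin ℂ hcomm
  exact ⟨Algebra.adjoin ℂ ({H, C} : Set (Matrix (Fin p) (Fin p) ℂ)), inferInstance, Subalgebra.algebra _, (Algebra.adjoin ℂ {H, C}).val,
    ⟨C, Algebra.subset_adjoin (by simp)⟩, ⟨H, Algebra.subset_adjoin (by simp)⟩, rfl, rfl⟩

theorem matPoch_algHom {R : Type*} [CommRing R] [Algebra ℂ R]
    (φ : R →ₐ[ℂ] Matrix (Fin p) (Fin p) ℂ) (a : R) (k : ℕ) :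
    matPoch (φ a) k = φ ((ascPochhammer R k).eval a) := by
  rw [matPoch, Polynomial.aeval_algHom_apply, ← ascPochhammer_map (algebraMap ℂ R),
    Polynomial.eval_map_algebraMap]

theorem commute_algHom_matWeight {R : Type*} [CommRing R] [Algebra ℂ R]
    (φ : R →ₐ[ℂ] Matrix (Fin p) (Fin p) ℂ) (c h x : R) (u : ℝ) :
    Commute (φ x) (matWeight (φ h) (φ c) u) :=
  commute_matWeight ((Commute.all x h).map φ) ((Commute.all x c).map φ) u

end MomentRelations

/-! ### The integrands as combinations of moment kernels -/

section Expansions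

open Finset

variable {p : ℕ} {R : Type*} [CommRing R] [Algebra ℂ R]

theorem smul_matWeight_mul_biorthM (φ : R →ₐ[ℂ] Matrix (Fin p) (Fin p) ℂ) (c h : R) (υ n i : ℕ)
    (hu : ∀ j ≤ n, IsUnit (matPoch (1 + φ c) (υ * j))) (u : ℝ) :
    (u : ℂ) ^ i • (matWeight (φ h) (φ c) u * biorthM υ n (φ h) (φ c) u) =
      ∑ j ∈ range (n + 1), φ ((-1) ^ (j + n) * (n.choose j : R) * (-1) ^ (υ * j) *
        ((ascPochhammer R (υ * j)).eval (n + 1 - h) *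
          (ascPochhammer R (υ * (n - j))).eval (1 + c + (υ * j : ℕ)))) *
        momentKernel (φ h) (φ c) (υ * j + i) 0 u := by
  rw [biorthM, mul_sum, smul_sum]
  refine sum_congr rfl fun j hj => ?_
  have hjn : j ≤ n := Nat.lt_succ_iff.mp (mem_range.mp hj)
  have e1 : ((n : ℂ) + 1) • (1 : Matrix (Fin p) (Fin p) ℂ) - φ h = φ (n + 1 - h) := by
    rw [← Algebra.algebraMap_eq_smul_one]; simp
  have e2 : (1 : Matrix (Fin p) (Fin p) ℂ) + φ c = φ (1 + c) := by simp
  -- The quotient of Pochhammer symbols is again one, `(1+C+υj)_(υ(n-j))`, which removes the inverse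
  -- and leaves an element of the image of `φ`.
  have e3 : matPoch (1 + φ c) (υ * n) * (matPoch (1 + φ c) (υ * j))⁻¹ =
      φ ((ascPochhammer R (υ * (n - j))).eval (1 + c + (υ * j : ℕ))) := by
    have h1 := ascPochhammer_eval_add_index (1 + c) (υ * j) (υ * (n - j))
    rw [← Nat.mul_add, Nat.add_sub_cancel' hjn,
      mul_comm (Polynomial.eval _ _)] at h1
    have h2 : matPoch (1 + φ c) (υ * n) =
        φ ((ascPochhammer R (υ * (n - j))).eval (1 + c + (υ * j : ℕ))) *
          matPoch (1 + φ c) (υ * j) := by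
      rw [e2, matPoch_algHom, matPoch_algHom, h1, map_mul]
    rw [h2]
    exact Matrix.mul_nonsing_inv_cancel_right _ _
      ((Matrix.isUnit_iff_isUnit_det _).mp (hu j hjn))
  rw [mul_assoc (matPoch _ _), e3, e1, matPoch_algHom, ← map_mul]
  set y := (ascPochhammer R (υ * j)).eval (n + 1 - h) *
    (ascPochhammer R (υ * (n - j))).eval (1 + c + (υ * j : ℕ))
  have e4 : (-1 : R) ^ (j + n) * (n.choose j : R) * (-1) ^ (υ * j) * y =
      ((-1 : ℂ) ^ (j + n) * (n.choose j : ℂ) * (-1) ^ (υ * j)) • y := by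
    rw [Algebra.smul_def]; simp
  rw [e4, map_smul, momentKernel, mul_smul_comm, smul_smul, smul_mul_smul_comm,
    (commute_algHom_matWeight φ c h y u).eq, neg_pow (u : ℂ) (υ * j)]
  congr 1
  ring

theorem smul_matWeight_mul_biorthCalM (φ : R →ₐ[ℂ] Matrix (Fin p) (Fin p) ℂ) (c h : R)
    (υ n k : ℕ) (u : ℝ) :
    (u : ℂ) ^ k • (matWeight (φ h) (φ c) u * biorthCalM υ n (φ h) (φ c) u) =
      ∑ s ∈ range (n + 1), φ (∑ j ∈ range (s + 1),
        ((-1 : R) ^ (j + n) * algebraMap ℂ R (s.factorial : ℂ)⁻¹ * (s.choose j : R) *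
          ((ascPochhammer R n).eval (algebraMap ℂ R (υ : ℂ)⁻¹ * (j + 1 + c)) *
            (ascPochhammer R s).eval (h + c - n)))) *
        momentKernel (φ h) (φ c) (k + s) (n - s) u := by
  rw [biorthCalM, mul_sum, smul_sum]
  refine sum_congr rfl fun s _ => ?_
  rw [mul_sum, smul_sum, map_sum, sum_mul]
  refine sum_congr rfl fun j _ => ?_
  have e1 : (1 / (υ : ℂ)) • (((j : ℂ) + 1) • (1 : Matrix (Fin p) (Fin p) ℂ) + φ c) =
      φ (algebraMap ℂ R (υ : ℂ)⁻¹ * (j + 1 + c)) := by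
    rw [← Algebra.smul_def, map_smul, one_div, ← Algebra.algebraMap_eq_smul_one]; simp
  have e2 : φ h + φ c - (n : ℂ) • (1 : Matrix (Fin p) (Fin p) ℂ) = φ (h + c - n) := by
    rw [← Algebra.algebraMap_eq_smul_one]; simp
  rw [e1, e2, matPoch_algHom, matPoch_algHom, ← map_mul]
  set y := (ascPochhammer R n).eval (algebraMap ℂ R (υ : ℂ)⁻¹ * (j + 1 + c)) *
    (ascPochhammer R s).eval (h + c - n)
  have e4 : (-1 : R) ^ (j + n) * algebraMap ℂ R (s.factorial : ℂ)⁻¹ * (s.choose j : R) * y =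
      ((-1 : ℂ) ^ (j + n) * (s.factorial : ℂ)⁻¹ * (s.choose j : ℂ)) • y := by
    rw [Algebra.smul_def]; simp
  rw [e4, map_smul, momentKernel, mul_smul_comm, smul_smul, smul_mul_smul_comm,
    (commute_algHom_matWeight φ c h y u).eq]
  congr 1
  ring

end Expansions

/-! ### Biorthogonality and nonvanishing -/

section MainTheorem

open Finset
open scoped Matrix.Norms.Operator

variable {p : ℕ}

attribute [local instance] matrixContinuousENorm matrixPseudoMetrizableSpace

theorem biorthM_integrals (hp : 1 ≤ p) {υ : ℕ} (hυ : 1 ≤ υ) (n : ℕ)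
    {H C : Matrix (Fin p) (Fin p) ℂ} (hHC : H * C = C * H)
    (hC : ∀ z ∈ spectrum ℂ C, -1 < z.re)
    (hH : ∀ x ∈ spectrum ℂ H, 1 + (1 + (υ : ℝ)) * (n : ℝ) < x.re) :
    (∀ i ≤ n, MatIntegrable fun u : ℝ =>
        (u : ℂ) ^ i • (matWeight H C u * biorthM υ n H C u)) ∧
      (∀ i < n, matIntegral (fun u : ℝ =>
        (u : ℂ) ^ i • (matWeight H C u * biorthM υ n H C u)) = 0) ∧
      matIntegral (fun u : ℝ =>
        (u : ℂ) ^ n • (matWeight H C u * biorthM υ n H C u)) ≠ 0 := by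
  obtain ⟨v, α, β, hv, hα, hβ⟩ := exists_joint_eigenvector hp hHC
  have hαs := hC α (mem_spectrum_of_mulVec_eq_smul hv hα)
  have hβs := hH β (mem_spectrum_of_mulVec_eq_smul hv hβ)
  have hbound : ∀ k ≤ υ * n + n, ∀ x ∈ spectrum ℂ H, (k : ℝ) + 1 < x.re := by
    intro k hk x hx
    have h1 := hH x hx
    have h2 : (k : ℝ) ≤ υ * n + n := by exact_mod_cast hk
    nlinarith
  have hbound0 : ∀ k ≤ υ * n + n, ∀ x ∈ spectrum ℂ H, (k : ℝ) + (0 : ℕ) + 1 < x.re := by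
    intro k hk x hx
    simpa using hbound k hk x hx
  have hunit : ∀ k, IsUnit (matPoch (1 + C) k) := by
    intro k
    refine isUnit_matPoch fun j _ hj => ?_
    have h1 : -(j : ℂ) - 1 ∈ spectrum ℂ C := by
      rw [spectrum.mem_iff] at hj ⊢
      convert hj using 2
      simp only [map_sub, map_neg, map_natCast, map_one]
      abel
    have h2 := hC _ h1
    simp at h2
    have : (0 : ℝ) ≤ j := by positivity
    linarith
  -- A singular factor would make some `j+2 ≤ n` an eigenvalue of `H`, below the assumed bound.
  have hunitH : IsUnit (matPoch (2 - H) (n - 1)) := by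
    refine isUnit_matPoch fun j hj hjs => ?_
    have h1 : (j : ℂ) + 2 ∈ spectrum ℂ H := by
      rw [spectrum.mem_iff] at hjs ⊢
      rw [← IsUnit.neg_iff]
      convert hjs using 2
      simp only [map_add, map_neg, map_natCast, map_ofNat]
      abel
    have h2 := hbound (j + 1) (by have := Nat.zero_le (υ * n); omega) _ h1
    simp at h2
    linarith
  obtain ⟨R, _, _, φ, c, h, rfl, rfl⟩ := exists_commRing_algHom hHC
  -- The moments need not be exhibited inside the commutative algebra: they are elements of a module
  -- on which it acts by left multiplication.
  let : Module R (Matrix (Fin p) (Fin p) ℂ) := Module.compHom _ φ.toRingHom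
  have hsmul : ∀ (r : R) (X : Matrix (Fin p) (Fin p) ℂ), r • X = φ r * X := fun _ _ => rfl
  have hJ : ∀ k ≤ υ * n + n, (ascPochhammer R k).eval (2 - h) • weightMoment (φ h) (φ c) k 0 =
      ((-1) ^ k * (ascPochhammer R k).eval (1 + c)) • weightMoment (φ h) (φ c) 0 0 := by
    intro k hk
    have := matPoch_mul_weightMoment_zero hHC hC (hbound k hk)
    have e1 : (2 : Matrix (Fin p) (Fin p) ℂ) - φ h = φ (2 - h) := by
      rw [map_sub, map_ofNat]
    have e2 : (1 : Matrix (Fin p) (Fin p) ℂ) + φ c = φ (1 + c) := by simp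
    rw [e1, e2, matPoch_algHom, matPoch_algHom] at this
    rw [hsmul, hsmul, this]
    simp
  have hexp : ∀ i ≤ n, _ := fun i hi => matIntegrable_and_matIntegral_eq_sum (range (n + 1))
    (fun j => φ ((-1) ^ (j + n) * (n.choose j : R) * (-1) ^ (υ * j) *
        ((ascPochhammer R (υ * j)).eval (n + 1 - h) *
          (ascPochhammer R (υ * (n - j))).eval (1 + c + (υ * j : ℕ)))))
    (fun j => υ * j + i) (fun _ => 0)
    (smul_matWeight_mul_biorthM φ c h υ n i fun j _ => hunit _)
    (fun j hj => integrableOn_momentKernel hHC hC (hbound0 _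
      (add_le_add (Nat.mul_le_mul_left υ (Nat.lt_succ_iff.mp (mem_range.mp hj))) hi)))
  refine ⟨fun i hi => (hexp i hi).1, fun i hi => ?_, ?_⟩
  · rw [(hexp i hi.le).2]
    have := ascPochhammer_smul_sum_moments_eq_zero c h (υ := υ) hi
      (fun k => weightMoment (φ h) (φ c) k 0) fun k hk => hJ k (by omega)
    simp only [hsmul] at this
    have e1 : (2 : Matrix (Fin p) (Fin p) ℂ) - φ h = φ (2 - h) := by
      rw [map_sub, map_ofNat]
    rw [e1, matPoch_algHom] at hunitH
    exact hunitH.mul_right_eq_zero.mp this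
  · rw [(hexp n le_rfl).2]
    intro h0
    obtain ⟨hJv, hB⟩ := weightMoment_mulVec_ne_zero hHC hC (hbound0 0 (Nat.zero_le _)) hv hα hβ
    -- For `n = 0` the index `n - 1` is truncated and the interpolation identity does not apply, but
    -- the integral is then `J 0` itself.
    rcases Nat.eq_zero_or_pos n with rfl | hn
    · simp at h0
      rw [h0, Matrix.zero_mulVec] at hJv
      exact smul_ne_zero hB hv hJv.symm
    · have := ascPochhammer_smul_sum_moments_eq c h hυ hn
        (fun k => weightMoment (φ h) (φ c) k 0) hJ
      simp only [hsmul] at this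
      rw [h0, mul_zero] at this
      have e1 : (υ : R) ^ n * (n.factorial : R) * (ascPochhammer R (υ * n)).eval (1 + c) *
          (ascPochhammer R n).eval (c + h - n) = ((υ : ℂ) ^ n * (n.factorial : ℂ)) •
          ((ascPochhammer R (υ * n)).eval (1 + c) * (ascPochhammer R n).eval (c + h - n)) := by
        rw [Algebra.smul_def]; simp [mul_assoc]
      rw [e1, map_smul, map_mul, ← matPoch_algHom, ← matPoch_algHom] at this
      have hq := matPoch_mulVec_of_mulVec_eq_smul (A := φ (1 + c)) (v := v) (α := 1 + α)
        (by rw [map_add, map_one, Matrix.add_mulVec, Matrix.one_mulVec, hα, add_smul, one_smul])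
        (υ * n)
      have hr := matPoch_mulVec_of_mulVec_eq_smul (A := φ (c + h - n)) (v := v)
        (α := α + β - n) (by
          rw [map_sub, map_add, map_natCast, Matrix.sub_mulVec, Matrix.add_mulVec, hα, hβ,
            ← add_smul, Matrix.natCast_mulVec, sub_smul]) n
      have hvec := congrArg (fun M => M.mulVec v) this
      simp only [Matrix.zero_mulVec, Matrix.smul_mulVec, ← Matrix.mulVec_mulVec, hJv,
        Matrix.mulVec_smul, hq, hr, smul_smul] at hvec
      refine smul_ne_zero ?_ hv hvec.symm
      have hn0 : (0 : ℝ) ≤ υ * n := by positivity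
      have h1 : (ascPochhammer ℂ (υ * n)).eval (1 + α) ≠ 0 :=
        ascPochhammer_eval_ne_zero (by simp; linarith) _
      -- The real part exceeds `-1 + 1 + (1+υ)n - n = υn ≥ 0`.
      have h2 : (ascPochhammer ℂ n).eval (α + β - n) ≠ 0 :=
        ascPochhammer_eval_ne_zero (by simp; nlinarith) _
      have h3 : (υ : ℂ) ≠ 0 := by exact_mod_cast (by omega : υ ≠ 0)
      have h4 : (n.factorial : ℂ) ≠ 0 := by exact_mod_cast n.factorial_ne_zero
      simp only [ne_eq, mul_eq_zero, pow_eq_zero_iff', not_or, h1, h2, h3, h4, hB]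
      simp

theorem biorthCalM_integrals (hp : 1 ≤ p) {υ : ℕ} (hυ : 1 ≤ υ) (n : ℕ)
    {H C : Matrix (Fin p) (Fin p) ℂ} (hHC : H * C = C * H)
    (hC : ∀ z ∈ spectrum ℂ C, -1 < z.re)
    (hH : ∀ x ∈ spectrum ℂ H, 1 + (1 + (υ : ℝ)) * (n : ℝ) < x.re) :
    (∀ i ≤ n, MatIntegrable fun u : ℝ =>
        (u : ℂ) ^ (υ * i) • (matWeight H C u * biorthCalM υ n H C u)) ∧
      (∀ i < n, matIntegral (fun u : ℝ =>
        (u : ℂ) ^ (υ * i) • (matWeight H C u * biorthCalM υ n H C u)) = 0) ∧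
      matIntegral (fun u : ℝ =>
        (u : ℂ) ^ (υ * n) • (matWeight H C u * biorthCalM υ n H C u)) ≠ 0 := by
  obtain ⟨v, α, β, hv, hα, hβ⟩ := exists_joint_eigenvector hp hHC
  have hbound : ∀ k m, k + m ≤ υ * n + n → ∀ x ∈ spectrum ℂ H, (k : ℝ) + m + 1 < x.re := by
    intro k m hk x hx
    have h1 := hH x hx
    have h2 : (k : ℝ) + m ≤ υ * n + n := by exact_mod_cast hk
    nlinarith
  obtain ⟨R, _, _, φ, c, h, rfl, rfl⟩ := exists_commRing_algHom hHC
  let : Module R (Matrix (Fin p) (Fin p) ℂ) := Module.compHom _ φ.toRingHom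
  have hsmul : ∀ (r : R) (X : Matrix (Fin p) (Fin p) ℂ), r • X = φ r * X := fun _ _ => rfl
  have hυi : ∀ i ≤ n, υ * i ≤ υ * n := fun i hi => Nat.mul_le_mul_left υ hi
  have hexp : ∀ i ≤ n, _ := fun i hi => matIntegrable_and_matIntegral_eq_sum (range (n + 1))
    (fun s => φ (∑ j ∈ range (s + 1),
        ((-1 : R) ^ (j + n) * algebraMap ℂ R (s.factorial : ℂ)⁻¹ * (s.choose j : R) *
          ((ascPochhammer R n).eval (algebraMap ℂ R (υ : ℂ)⁻¹ * (j + 1 + c)) *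
            (ascPochhammer R s).eval (h + c - n)))))
    (fun s => υ * i + s) (fun s => n - s)
    (smul_matWeight_mul_biorthCalM φ c h υ n (υ * i))
    (fun s hs => integrableOn_momentKernel hHC hC (hbound _ _ (by
      have := Nat.lt_succ_iff.mp (mem_range.mp hs)
      have := hυi i hi
      omega)))
  have hval : ∀ i ≤ n, matIntegral (fun u : ℝ =>
      (u : ℂ) ^ (υ * i) • (matWeight (φ h) (φ c) u * biorthCalM υ n (φ h) (φ c) u)) =
      φ ((-1) ^ n * (ascPochhammer R n).eval (-(i : R))) *
        weightMoment (φ h) (φ c) (υ * i) n := by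
    intro i hi
    rw [(hexp i hi).2]
    have hK : ∀ s ≤ n, (ascPochhammer R s).eval (h + c - n) •
        weightMoment (φ h) (φ c) (υ * i + s) (n - s) =
        (ascPochhammer R s).eval (1 + c + (υ * i : ℕ)) •
          weightMoment (φ h) (φ c) (υ * i + 0) (n - 0) := by
      intro s hs
      have := matPoch_mul_weightMoment hHC hC
        (hbound (υ * i) n (Nat.add_le_add_right (hυi i hi) n)) hs
      have e1 : φ h + φ c - (n : ℂ) • (1 : Matrix (Fin p) (Fin p) ℂ) = φ (h + c - n) := by
        rw [← Algebra.algebraMap_eq_smul_one]; simp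
      have e2 : 1 + φ c + ((υ * i : ℕ) : ℂ) • (1 : Matrix (Fin p) (Fin p) ℂ) =
          φ (1 + c + (υ * i : ℕ)) := by
        rw [← Algebra.algebraMap_eq_smul_one]; simp
      rw [e1, e2, matPoch_algHom, matPoch_algHom] at this
      exact this
    have := sum_sum_moments_eq c h hυ
      (fun s => weightMoment (φ h) (φ c) (υ * i + s) (n - s)) hK
    simp only [← sum_smul] at this
    exact this
  refine ⟨fun i hi => (hexp i hi).1, fun i hi => ?_, ?_⟩
  -- For `i < n` the product `(-i)_n` contains the factor `-i + i`. For `i = n` it equals `(-1)^n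
  -- n!`.
  · rw [hval i hi.le, ascPochhammer_eval_neg_coe_nat_of_lt hi, mul_zero, map_zero, zero_mul]
  · rw [hval n le_rfl]
    intro h0
    obtain ⟨hKv, hB⟩ := weightMoment_mulVec_ne_zero hHC hC (hbound (υ * n) n le_rfl) hv hα hβ
    have e1 : (-1 : R) ^ n * (ascPochhammer R n).eval (-(n : R)) =
        ((-1 : ℂ) ^ n) • (ascPochhammer R n).eval (-(n : R)) := by
      rw [Algebra.smul_def]; simp
    rw [e1, map_smul, ← matPoch_algHom] at h0
    have hq := matPoch_mulVec_of_mulVec_eq_smul (A := φ (-(n : R))) (v := v) (α := -(n : ℂ))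
      (by rw [map_neg, map_natCast, Matrix.neg_mulVec, Matrix.natCast_mulVec, neg_smul]) n
    have hvec := congrArg (fun M => M.mulVec v) h0
    simp only [Matrix.zero_mulVec, Matrix.smul_mulVec, smul_mul_assoc, ← Matrix.mulVec_mulVec, hKv,
      Matrix.mulVec_smul, hq, smul_smul, ascPochhammer_eval_neg_natCast] at hvec
    refine smul_ne_zero ?_ hv hvec
    have h4 : (n.factorial : ℂ) ≠ 0 := by exact_mod_cast n.factorial_ne_zero
    simp only [ne_eq, mul_eq_zero, pow_eq_zero_iff', not_or, h4, hB]
    simp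

end MainTheorem

theorem mainTheorem7 (p : ℕ) (hp : 1 ≤ p) (υ : ℕ) (hυ : 1 ≤ υ) (n : ℕ)
    (H C : Matrix (Fin p) (Fin p) ℂ) (hHC : H * C = C * H)
    (hC : ∀ z ∈ spectrum ℂ C, -1 < z.re)
    (hH : ∀ x ∈ spectrum ℂ H, 1 + (1 + (υ : ℝ)) * (n : ℝ) < x.re) :
    ((∀ i ≤ n, MatIntegrable fun u : ℝ =>
          (u : ℂ) ^ i • (matWeight H C u * biorthM υ n H C u)) ∧
      (∀ i < n, matIntegral (fun u : ℝ =>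
          (u : ℂ) ^ i • (matWeight H C u * biorthM υ n H C u)) = 0) ∧
      matIntegral (fun u : ℝ =>
          (u : ℂ) ^ n • (matWeight H C u * biorthM υ n H C u)) ≠ 0) ∧
    ((∀ i ≤ n, MatIntegrable fun u : ℝ =>
          (u : ℂ) ^ (υ * i) • (matWeight H C u * biorthCalM υ n H C u)) ∧
      (∀ i < n, matIntegral (fun u : ℝ =>
          (u : ℂ) ^ (υ * i) • (matWeight H C u * biorthCalM υ n H C u)) = 0) ∧
      matIntegral (fun u : ℝ =>
          (u : ℂ) ^ (υ * n) • (matWeight H C u * biorthCalM υ n H C u)) ≠ 0) :=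
  ⟨biorthM_integrals hp hυ n hHC hC hH, biorthCalM_integrals hp hυ n hHC hC hH⟩
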